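/- For a finite graph $G$ on $n\ge 2$ vertices let $\lambda_1(G)\ge\lambda_2(G)\ge\cdots\ge\lambda_n(G)$ be the eigenvalues of its adjacency matrix, with multiplicity; the second eigenvalue multiplicity of $G$ is the number of $j$ with $\lambda_j(G)=\lambda_2(G)$. There exist infinitely many connected $n$-vertex graphs with maximum degree $4$ and second eigenvalue multiplicity at least $\sqrt{n/\log_2 n}$; that is, such a graph exists for infinitely many $n$. Such graphs are constructed as follows. Let $q\ge 4$ be a prime power and let $\Gamma=\mathbb F_q^\times\ltimes\mathbb F_q$, where $\mathbb F_q^\times$ acts on the additive group $\mathbb F_q$ by multiplication. Let $s$ be any generator of $\mathbb F_q^\times\le\Gamma$ and let $t$ be any element of $\Gamma\setminus\mathbb F_q^\times$ with $t\ne t^{-1}$. Take the Cayley graph $\operatorname{Cay}(\Gamma,\{s,s^{-1},t,t^{-1}\})$, whose vertices are the elements of $\Gamma$ and whose edges are the pairs $\{g,gx\}$ with $g\in\Gamma$ and $x\in\{s,s^{-1},t,t^{-1}\}$, and replace each edge generated by $t$ or $t^{-1}$ by a path of $m=\lceil 2\log_2(q-1)\rceil-2$ edges with the same endpoints (and its own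 $m-1$ new inner vertices). The resulting graph has $n=q(q-1)m$ vertices, is connected, has maximum degree $4$, and its second eigenvalue multiplicity is at least $q-1$ and at least $\sqrt{n/\log_2 n}$. -/

import Mathlib

section Spectrum

/-- The maximum degree of a finite graph. -/
noncomputable def graphMaxDegree {V : Type*} [Fintype V] (G : SimpleGraph V) : ℕ := by
  classical exact G.maxDegree

/-- The eigenvalues `λ₁ ≥ λ₂ ≥ ⋯ ≥ λₙ` of the adjacency matrix of a finite graph, listed in
decreasing order and with multiplicity; the index `j : Fin n` stands for `λ_{j+1}`. -/
noncomputable def adjEigenvalue {V : Type*} [Fintype V] (G : SimpleGraph V) :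
    Fin (Fintype.card V) → ℝ := by
  classical exact (G.isHermitian_adjMatrix (R := ℝ)).eigenvalues₀

/-- The multiplicity of the second largest adjacency eigenvalue `λ₂`: the number of `j` with
`λ_j = λ₂`. (On a graph with fewer than two vertices there is no `λ₂`, and the value is `0`.) -/
noncomputable def secondEigenvalueMultiplicity {V : Type*} [Fintype V] (G : SimpleGraph V) : ℕ :=
  Nat.card {j : Fin (Fintype.card V) //
    ∃ h : 1 < Fintype.card V, adjEigenvalue G j = adjEigenvalue G ⟨1, h⟩}

end Spectrum

section Paths

/-- The `k`-th vertex (`0 ≤ k ≤ m`) of the `m`-edge path with index `i`, leading from `a i` to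
`b i` through the `m - 1` new vertices `(i, 0), …, (i, m - 2)`. -/
def pathVertex {V ι : Type*} (a b : ι → V) (m : ℕ) (i : ι) (k : ℕ) : V ⊕ ι × Fin (m - 1) :=
  if k = 0 then Sum.inl (a i)
  else if h : k - 1 < m - 1 then Sum.inr (i, ⟨k - 1, h⟩)
  else Sum.inl (b i)

/-- The graph obtained from `H` by replacing each of the edges `{a i, b i}` by a path of `m` edges
with the same endpoints: these edges are deleted from `H`, and for each `i` a new path of `m` edges
(with its own `m - 1` inner vertices) from `a i` to `b i` is put in. It is meant for `m ≥ 1` and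
for families in which each edge to be replaced occurs exactly once. -/
def replaceEdgesByPaths {V ι : Type*} (H : SimpleGraph V) (a b : ι → V) (m : ℕ) :
    SimpleGraph (V ⊕ ι × Fin (m - 1)) :=
  SimpleGraph.fromRel fun x y =>
    (∃ u v, (H.deleteEdges (Set.range fun i => s(a i, b i))).Adj u v ∧
      x = Sum.inl u ∧ y = Sum.inl v) ∨
    (∃ i, ∃ k < m, x = pathVertex a b m i k ∧ y = pathVertex a b m i (k + 1))

end Paths

section AffineGroup

/-- The action of `Fˣ` on the additive group of `F` by multiplication. -/
def unitsMulHom (F : Type*) [Field F] : Fˣ →* MulAut (Multiplicative F) where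
  toFun u := AddEquiv.toMultiplicative (DistribMulAction.toAddEquiv F u)
  map_one' := by
    ext x
    exact congrArg Multiplicative.ofAdd (one_smul Fˣ x.toAdd)
  map_mul' u v := by
    ext x
    exact congrArg Multiplicative.ofAdd (mul_smul u v x.toAdd)

/-- The semidirect product `Fˣ ⋉ F` for the action of `Fˣ` on `F` by multiplication, that is, the
affine group of `F`. Its complement `Fˣ` is the range of `SemidirectProduct.inr`. -/
abbrev AffGroup (F : Type*) [Field F] : Type _ :=
  Multiplicative F ⋊[unitsMulHom F] Fˣ

noncomputable instance AffGroup.instFintype (F : Type*) [Field F] [Fintype F] :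
    Fintype (AffGroup F) := by
  classical exact Fintype.ofEquiv (Multiplicative F × Fˣ) SemidirectProduct.equivProd.symm

/-- The graph obtained from the Cayley graph of `Fˣ ⋉ F` with generators `s, s⁻¹, t, t⁻¹`
(vertices `g`, edges `{g, g s}` and `{g, g t}`) by replacing each edge `{g, g t}` generated by `t`
or `t⁻¹` by a path of `m` edges. If `t ≠ t⁻¹`, then each of these edges is `{g, g t}` for exactly
one `g`, so the paths are indexed by `g`. -/
def affinePathGraph {F : Type*} [Field F] (s : Fˣ) (t : AffGroup F) (m : ℕ) :
    SimpleGraph (AffGroup F ⊕ AffGroup F × Fin (m - 1)) :=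
  replaceEdgesByPaths
    (SimpleGraph.mulCayley
      ({SemidirectProduct.inr s, (SemidirectProduct.inr s)⁻¹, t, t⁻¹} : Set (AffGroup F)))
    (fun g => g) (fun g => g * t) m

/-- The number `⌈2 log₂ (q - 1)⌉ - 2` of edges of each of the paths. -/
noncomputable def pathLength (q : ℕ) : ℕ := ⌈2 * Real.logb 2 ((q : ℝ) - 1)⌉₊ - 2

end AffineGroup

/-! The group `Γ = Fˣ ⋉ F` acts on the graph by left translations, so every adjacency eigenspace is
a representation of `Γ`. If `F` acts nontrivially on a representation of `Γ`, then its dimension is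
at least `q - 1`: the nontrivial elements of `F` are conjugate in `Γ`, hence have the same trace,
which is rational and an algebraic integer. So it is enough to show that the eigenvectors of the two
largest eigenvalues are not both `F`-invariant, and for this that, for some `μ`,

* the quadratic form of the adjacency matrix is at most `μ` on the `F`-invariant functions with sum
  zero over `Γ`;
* it exceeds `μ` on a space of dimension at least two, so that `λ₂ > μ`.

The restriction of an `F`-invariant function to `Γ` is a function on the `(q - 1)`-cycle `Fˣ`. If
its mean is zero, Wirtinger's inequality bounds the contribution of the edges generated by `s`, and
the inequality of arithmetic and geometric means, weighted by a positive solution of the eigenvalue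
equation for `μ`, bounds that of the paths. The large form is attained by the functions on `F`,
viewed as functions on `Γ` constant on the cosets of `Fˣ` and extended to the paths by solutions of
the eigenvalue equation. The length of the paths is such that both estimates hold for the same `μ`.
-/

section SymmetricOperators

open Module RCLike InnerProductSpace

variable {𝕜 E : Type*} [RCLike 𝕜] [NormedAddCommGroup E] [InnerProductSpace 𝕜 E]
  [FiniteDimensional 𝕜 E] {T : E →ₗ[𝕜] E} (hT : T.IsSymmetric) {n : ℕ} (hn : finrank 𝕜 E = n)

theorem re_inner_apply_self_eq_sum_eigenvalues (x : E) :
    re ⟪x, T x⟫_𝕜 = ∑ i, hT.eigenvalues hn i * ‖⟪hT.eigenvectorBasis hn i, x⟫_𝕜‖ ^ 2 := by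
  rw [← (hT.eigenvectorBasis hn).sum_inner_mul_inner, map_sum]
  refine Finset.sum_congr rfl fun i _ => ?_
  rw [← hT (hT.eigenvectorBasis hn i) x, hT.apply_eigenvectorBasis, inner_smul_left, conj_ofReal,
    mul_left_comm, re_ofReal_mul, inner_mul_symm_re_eq_norm, norm_mul, norm_inner_symm, sq]

theorem re_inner_apply_self_le_of_inner_eigenvectorBasis_eq_zero {i : Fin n} {x : E}
    (hx : ∀ j < i, ⟪hT.eigenvectorBasis hn j, x⟫_𝕜 = 0) :
    re ⟪x, T x⟫_𝕜 ≤ hT.eigenvalues hn i * ‖x‖ ^ 2 := by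
  rw [re_inner_apply_self_eq_sum_eigenvalues hT hn,
    ← (hT.eigenvectorBasis hn).sum_sq_norm_inner_right, Finset.mul_sum]
  refine Finset.sum_le_sum fun j _ => ?_
  obtain hj | hj := lt_or_ge j i
  · simp [hx j hj]
  · gcongr
    exact hT.eigenvalues_antitone hn hj

theorem le_re_inner_apply_self_of_inner_eigenvectorBasis_eq_zero {i : Fin n} {x : E}
    (hx : ∀ j, i < j → ⟪hT.eigenvectorBasis hn j, x⟫_𝕜 = 0) :
    hT.eigenvalues hn i * ‖x‖ ^ 2 ≤ re ⟪x, T x⟫_𝕜 := by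
  rw [re_inner_apply_self_eq_sum_eigenvalues hT hn,
    ← (hT.eigenvectorBasis hn).sum_sq_norm_inner_right, Finset.mul_sum]
  refine Finset.sum_le_sum fun j _ => ?_
  obtain hj | hj := lt_or_ge i j
  · simp [hx j hj]
  · gcongr
    exact hT.eigenvalues_antitone hn hj

theorem lt_eigenvalues_of_lt_finrank {i : Fin n} {μ : ℝ} {U : Submodule 𝕜 E}
    (hi : i < finrank 𝕜 U) (hU : ∀ x ∈ U, x ≠ 0 → μ * ‖x‖ ^ 2 < re ⟪x, T x⟫_𝕜) :
    μ < hT.eigenvalues hn i := by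
  let coords : U →ₗ[𝕜] Fin i → 𝕜 := LinearMap.pi fun j =>
    (innerₛₗ 𝕜 (hT.eigenvectorBasis hn (j.castLE i.is_lt.le))).domRestrict U
  obtain ⟨x, hx, hx0⟩ := Submodule.exists_mem_ne_zero_of_ne_bot
    (LinearMap.ker_ne_bot_of_finrank_lt (f := coords) (by simpa using hi))
  have hx0' : (x : E) ≠ 0 := by simpa using hx0
  have hle := re_inner_apply_self_le_of_inner_eigenvectorBasis_eq_zero hT hn (i := i) (x := x)
    fun j hj => congrFun (LinearMap.mem_ker.mp hx) ⟨j, hj⟩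
  exact lt_of_mul_lt_mul_right ((hU x x.2 hx0').trans_le hle) (sq_nonneg _)

theorem eigenvalues_le_of_finrank_le {W : Type*} [AddCommGroup W] [Module 𝕜 W]
    [FiniteDimensional 𝕜 W] {i : Fin n} {μ : ℝ} {N : Submodule 𝕜 E}
    (hN : ∀ j ≤ i, hT.eigenvectorBasis hn j ∈ N) (L : E →ₗ[𝕜] W) (hL : finrank 𝕜 W ≤ i)
    (hμ : ∀ x ∈ N, L x = 0 → re ⟪x, T x⟫_𝕜 ≤ μ * ‖x‖ ^ 2) :
    hT.eigenvalues hn i ≤ μ := by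
  let b := hT.eigenvectorBasis hn
  let S : (Finset.Iic i → 𝕜) →ₗ[𝕜] E := Fintype.linearCombination 𝕜 fun j => b j
  obtain ⟨c, hc, hc0⟩ := Submodule.exists_mem_ne_zero_of_ne_bot
    (LinearMap.ker_ne_bot_of_finrank_lt (f := L ∘ₗ S)
      (by rw [finrank_fintype_fun_eq_card, Fintype.card_coe, Fin.card_Iic]; omega))
  have hb : LinearIndependent 𝕜 fun j : Finset.Iic i => b j :=
    b.orthonormal.linearIndependent.comp _ Subtype.val_injective
  have hS0 : S c ≠ 0 := fun h =>
    hc0 (hb.fintypeLinearCombination_injective (by rw [map_zero]; exact h))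
  have hSN : S c ∈ N := Submodule.sum_mem _ fun j _ =>
    N.smul_mem _ (hN j (Finset.mem_Iic.mp j.2))
  have hle := le_re_inner_apply_self_of_inner_eigenvectorBasis_eq_zero hT hn (i := i) (x := S c)
    fun j hj => by
      rw [Fintype.linearCombination_apply, inner_sum]
      refine Finset.sum_eq_zero fun k _ => ?_
      rw [inner_smul_right, b.inner_eq_zero, mul_zero]
      exact ((Finset.mem_Iic.mp k.2).trans_lt hj).ne'
  exact le_of_mul_le_mul_right (hle.trans (hμ _ hSN hc)) (by positivity)

/-- The eigenvectors of the two largest eigenvalues cannot both lie in `N`, since a combination of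
them would be in the kernel of `ℓ`. So one of the two eigenspaces is not contained in `N`; if it is
the first one, its dimension forces the two eigenvalues to agree. -/
theorem le_card_eigenvalues_eq_of_eigenspace_le (h1 : 1 < n) {d : ℕ} (hd : 2 ≤ d) {μ : ℝ}
    {U : Submodule 𝕜 E} (hU : 2 ≤ finrank 𝕜 U)
    (hUμ : ∀ x ∈ U, x ≠ 0 → μ * ‖x‖ ^ 2 < re ⟪x, T x⟫_𝕜) {N : Submodule 𝕜 E}
    (hN : ∀ c : 𝕜, End.eigenspace T c ≤ N ∨ d ≤ finrank 𝕜 (End.eigenspace T c))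
    (ℓ : E →ₗ[𝕜] 𝕜) (hNμ : ∀ x ∈ N, ℓ x = 0 → re ⟪x, T x⟫_𝕜 ≤ μ * ‖x‖ ^ 2) :
    d ≤ Finset.card {j | hT.eigenvalues hn j = hT.eigenvalues hn ⟨1, h1⟩} := by
  have hlt : μ < hT.eigenvalues hn ⟨1, h1⟩ := lt_eigenvalues_of_lt_finrank hT hn hU hUμ
  have hmem (j : Fin n) : hT.eigenvectorBasis hn j ∈ End.eigenspace T (hT.eigenvalues hn j : 𝕜) :=
    End.mem_eigenspace_iff.mpr (hT.apply_eigenvectorBasis hn j)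
  obtain ⟨j, hj, hjN⟩ : ∃ j ≤ (⟨1, h1⟩ : Fin n), hT.eigenvectorBasis hn j ∉ N := by
    by_contra! h
    exact hlt.not_ge (eigenvalues_le_of_finrank_le hT hn h ℓ (by simp) hNμ)
  have hdj : d ≤ Finset.card {k | hT.eigenvalues hn k = hT.eigenvalues hn j} := by
    have := hT.card_filter_eigenvalues_eq hn (hT.eigenvalues hn j)
    simp only [ofReal_inj] at this
    rw [this]
    exact (hN _).resolve_left fun h => hjN (h (hmem j))
  suffices hT.eigenvalues hn j = hT.eigenvalues hn ⟨1, h1⟩ by rwa [← this]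
  obtain ⟨k, hk, hk0⟩ := Finset.exists_mem_ne (hd.trans hdj) ⟨0, by omega⟩
  have hk1 : ⟨1, h1⟩ ≤ k := Nat.one_le_iff_ne_zero.mpr fun h => hk0 (Fin.ext h)
  refine le_antisymm ?_ (hT.eigenvalues_antitone hn hj)
  rw [← (Finset.mem_filter.mp hk).2]
  exact hT.eigenvalues_antitone hn hk1

end SymmetricOperators

theorem secondEigenvalueMultiplicity_eq_card {V : Type*} [Fintype V] [DecidableEq V]
    (G : SimpleGraph V) [DecidableRel G.Adj] (h : 1 < Fintype.card V) :
    secondEigenvalueMultiplicity G =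
      Finset.card {j | (G.isHermitian_adjMatrix (R := ℝ)).eigenvalues₀ j =
        (G.isHermitian_adjMatrix (R := ℝ)).eigenvalues₀ ⟨1, h⟩} := by
  have hG : adjEigenvalue G = (G.isHermitian_adjMatrix (R := ℝ)).eigenvalues₀ := by
    unfold adjEigenvalue
    congr!
  simp only [secondEigenvalueMultiplicity, h, hG, exists_true_left, Nat.card_eq_fintype_card,
    Fintype.card_subtype]

open Module Matrix in
theorem le_secondEigenvalueMultiplicity {V : Type*} [Fintype V] (G : SimpleGraph V)
    [DecidableRel G.Adj] {d : ℕ} (hd : 2 ≤ d) {μ : ℝ} {U : Submodule ℝ (V → ℝ)}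
    (hU : 2 ≤ finrank ℝ U)
    (hUμ : ∀ f ∈ U, f ≠ 0 → μ * f ⬝ᵥ f < f ⬝ᵥ G.adjMatrix ℝ *ᵥ f) {N : Submodule ℝ (V → ℝ)}
    (hN : ∀ c, End.eigenspace (G.adjMatrix ℝ).mulVecLin c ≤ N ∨
      d ≤ finrank ℝ (End.eigenspace (G.adjMatrix ℝ).mulVecLin c))
    (ℓ : (V → ℝ) →ₗ[ℝ] ℝ) (hNμ : ∀ f ∈ N, ℓ f = 0 → f ⬝ᵥ G.adjMatrix ℝ *ᵥ f ≤ μ * f ⬝ᵥ f) :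
    d ≤ secondEigenvalueMultiplicity G := by
  classical
  let e := WithLp.linearEquiv 2 ℝ (V → ℝ)
  let T := (G.adjMatrix ℝ).toEuclideanLin
  have hT : T.IsSymmetric := isSymmetric_toEuclideanLin_iff.mpr (G.isHermitian_adjMatrix (R := ℝ))
  have hform (x : EuclideanSpace ℝ V) :
      inner ℝ x (T x) = e x ⬝ᵥ G.adjMatrix ℝ *ᵥ e x := by
    rw [EuclideanSpace.inner_eq_star_dotProduct, star_trivial, dotProduct_comm]
    rfl
  have hnorm (x : EuclideanSpace ℝ V) : ‖x‖ ^ 2 = e x ⬝ᵥ e x := by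
    rw [← real_inner_self_eq_norm_sq, EuclideanSpace.inner_eq_star_dotProduct, star_trivial]
    rfl
  have heig (c : ℝ) : End.eigenspace T c =
      (End.eigenspace (G.adjMatrix ℝ).mulVecLin c).comap e.toLinearMap := by
    ext x
    simp only [Submodule.mem_comap, End.mem_eigenspace_iff]
    exact e.injective.eq_iff.symm
  have hfinrank (W : Submodule ℝ (V → ℝ)) : finrank ℝ (W.comap e.toLinearMap) = finrank ℝ W :=
    (e.ofSubmodule' W).finrank_eq
  have hcard : 1 < Fintype.card V := by
    rw [← finrank_fintype_fun_eq_card ℝ (η := V)]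
    exact hU.trans U.finrank_le
  rw [secondEigenvalueMultiplicity_eq_card G hcard]
  refine le_card_eigenvalues_eq_of_eigenspace_le hT finrank_euclideanSpace hcard hd (μ := μ)
    (U := U.comap e.toLinearMap) (by rwa [hfinrank]) (fun x hx hx0 => ?_)
    (N := N.comap e.toLinearMap) (fun c => ?_) (ℓ ∘ₗ e.toLinearMap) (fun x hx hℓ => ?_)
  · rw [hnorm, RCLike.re_to_real, hform]
    exact hUμ _ hx fun h => hx0 (e.injective (by rw [h, map_zero]))
  · rw [heig, hfinrank]
    exact (hN c).imp_left (Submodule.comap_mono ·)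
  · rw [hnorm, RCLike.re_to_real, hform]
    exact hNμ _ hx hℓ

open Module TensorProduct in
theorem isIntegral_trace_of_pow_eq_one {K W : Type*} [Field K] [AddCommGroup W] [Module K W]
    [FiniteDimensional K W] {f : End K W} {n : ℕ} (hn : n ≠ 0) (hf : f ^ n = 1) :
    IsIntegral ℤ (LinearMap.trace K W f) := by
  let L := AlgebraicClosure K
  let g : End L (L ⊗[K] W) := f.baseChange L
  have hg : g ^ n = 1 := by rw [← LinearMap.baseChange_pow, hf, LinearMap.baseChange_one]
  have htrace : algebraMap K L (LinearMap.trace K W f) = g.charpoly.roots.sum := by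
    rw [← LinearMap.trace_baseChange,
      End.trace_eq_sum_roots_charpoly_of_splits (IsAlgClosed.splits _)]
  rw [← isIntegral_algebraMap_iff (algebraMap K L).injective, htrace]
  refine IsIntegral.multiset_sum fun c hc => ?_
  obtain ⟨v, hv⟩ := ((End.hasEigenvalue_iff_isRoot_charpoly g c).mpr
    (Polynomial.isRoot_of_mem_roots hc)).exists_hasEigenvector
  have hcn : c ^ n = 1 := by
    have := hv.pow_apply n
    rw [hg, End.one_apply] at this
    exact smul_left_injective L hv.2 (by simpa using this.symm)
  exact .of_pow (Nat.pos_of_ne_zero hn) (hcn ▸ isIntegral_one)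

namespace AffGroup

open Module SemidirectProduct

variable {F K W : Type*} [Field F] [Field K] [AddCommGroup W] [Module K W]

theorem inl_ofAdd_units_val (u : Fˣ) :
    (inl (Multiplicative.ofAdd (u : F)) : AffGroup F) =
      inr u * inl (Multiplicative.ofAdd 1) * inr u⁻¹ := by
  rw [← inl_aut]
  congr 1
  exact congrArg Multiplicative.ofAdd (mul_one (u : F)).symm

theorem trace_inl_eq_trace_inl_one (ρ : Representation K (AffGroup F) W) {a : Multiplicative F}
    (ha : a ≠ 1) : LinearMap.trace K W (ρ (inl a)) =
      LinearMap.trace K W (ρ (inl (Multiplicative.ofAdd 1))) := by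
  have := inl_ofAdd_units_val (Units.mk0 a.toAdd ha)
  rw [show inl a = _ from this, map_mul, LinearMap.trace_mul_comm, ← map_mul, ← mul_assoc,
    ← map_mul, inv_mul_cancel, map_one, one_mul]

variable [Fintype F] [FiniteDimensional K W]

theorem card_mul_finrank_invariants_inl [CharZero K] (ρ : Representation K (AffGroup F) W) :
    (Fintype.card F : K) * finrank K (Representation.invariants (ρ.comp inl)) =
      finrank K W + (Fintype.card F - 1 : K) *
        LinearMap.trace K W (ρ (inl (Multiplicative.ofAdd 1))) := by
  classical
  have hq : (Fintype.card (Multiplicative F) : K) ≠ 0 := Nat.cast_ne_zero.mpr Fintype.card_ne_zero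
  let := invertibleOfNonzero hq
  have hsum : (Fintype.card F : K) * finrank K (Representation.invariants (ρ.comp inl)) =
      ∑ a, LinearMap.trace K W (ρ (inl a)) := by
    rw [← (Representation.isProj_averageMap (ρ.comp inl)).trace, ← Fintype.card_multiplicative F]
    simp only [Representation.averageMap, GroupAlgebra.average, map_smul, map_sum,
      Representation.asAlgebraHom_of, MonoidHom.comp_apply, smul_eq_mul]
    exact mul_invOf_cancel_left _ _
  rw [hsum, Fintype.sum_eq_add_sum_subtype_ne _ (1 : Multiplicative F), map_one, map_one,
    LinearMap.trace_one]
  congr 1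
  rw [Fintype.sum_congr _ _ fun a => trace_inl_eq_trace_inl_one ρ a.2]
  simp [Fintype.card_subtype_compl, Nat.cast_pred Fintype.card_pos]

theorem exists_finrank_eq_add [CharZero K] (ρ : Representation K (AffGroup F) W) :
    ∃ c : ℤ, (finrank K W : ℤ) =
      finrank K (Representation.invariants (ρ.comp inl)) + (Fintype.card F - 1) * c := by
  let k := finrank K (Representation.invariants (ρ.comp inl))
  let q := Fintype.card F
  have hq : (q - 1 : ℚ) ≠ 0 := sub_ne_zero.mpr (Nat.cast_ne_one.mpr Fintype.one_lt_card.ne')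
  set τ := LinearMap.trace K W (ρ (inl (Multiplicative.ofAdd 1)))
  have hτ : IsIntegral ℤ τ := isIntegral_trace_of_pow_eq_one (n := q) Fintype.card_ne_zero <| by
    rw [← map_pow ρ, ← map_pow inl, ← ofAdd_nsmul, nsmul_one, FiniteField.cast_card_eq_zero,
      ofAdd_zero, map_one, map_one]
  have hτ' : algebraMap ℚ K ((q * k - finrank K W) / (q - 1)) = τ := by
    have hqK : (q - 1 : K) ≠ 0 := by exact_mod_cast (algebraMap ℚ K).injective.ne hq
    have := card_mul_finrank_invariants_inl ρ
    push_cast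
    field_simp
    linear_combination this
  obtain ⟨c, hc⟩ := IsIntegrallyClosed.isIntegral_iff.mp
    ((isIntegral_algebraMap_iff (algebraMap ℚ K).injective).mp (hτ' ▸ hτ))
  refine ⟨k - c, ?_⟩
  rw [eq_intCast, eq_div_iff hq] at hc
  have : (finrank K W : ℚ) = k + (q - 1) * (k - c) := by linear_combination hc
  exact_mod_cast this

theorem card_sub_one_le_finrank [CharZero K] (ρ : Representation K (AffGroup F) W)
    (hρ : Representation.invariants (ρ.comp inl) ≠ ⊤) : Fintype.card F - 1 ≤ finrank K W := by
  obtain ⟨c, hc⟩ := exists_finrank_eq_add ρ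
  have hlt := Submodule.finrank_lt hρ
  have hq : 1 < Fintype.card F := Fintype.one_lt_card
  have hc0 : 0 < c := by
    by_contra! h
    nlinarith
  zify [hq.le]
  nlinarith

theorem le_invariants_inl_or_card_sub_one_le_finrank [CharZero K]
    {ρ : Representation K (AffGroup F) W} (U : Subrepresentation ρ) :
    U.toSubmodule ≤ Representation.invariants (ρ.comp inl) ∨
      Fintype.card F - 1 ≤ finrank K U.toSubmodule := by
  refine or_iff_not_imp_left.mpr fun hU => card_sub_one_le_finrank U.toRepresentation fun htop => ?_
  refine hU fun x hx a => ?_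
  have hfixed := Submodule.eq_top_iff'.mp htop ⟨x, hx⟩
  exact congrArg Subtype.val (hfixed a)

end AffGroup

section Wirtinger

open Complex

/-- Replacing `k` by `n - k` if necessary, the angle `2 π k / n` lies in `[2 π / n, π]`. -/
theorem cos_two_pi_mul_div_le {k n : ℕ} (hk : k ≠ 0) (hkn : k < n) :
    Real.cos (2 * Real.pi * (k / n)) ≤ Real.cos (2 * Real.pi / n) := by
  have hn : (0 : ℝ) < n := Nat.cast_pos.mpr (Nat.zero_lt_of_lt hkn)
  have key {j : ℝ} (h1 : 1 ≤ j) (h2 : 2 * j ≤ n) :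
      Real.cos (2 * Real.pi * (j / n)) ≤ Real.cos (2 * Real.pi / n) := by
    have hj : j / n ≤ 1 / 2 := by rw [div_le_iff₀ hn]; linarith
    refine Real.cos_le_cos_of_nonneg_of_le_pi (by positivity) ?_ ?_
    · nlinarith [Real.pi_pos]
    · rw [div_eq_mul_one_div]
      gcongr
  obtain h | h := le_total (2 * k) n
  · exact key (mod_cast Nat.one_le_iff_ne_zero.mpr hk) (mod_cast h)
  · have hrefl : 2 * Real.pi * (k / n) = 2 * Real.pi - 2 * Real.pi * (((n - k : ℕ) : ℝ) / n) := by
      rw [Nat.cast_sub hkn.le]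
      field_simp
      ring
    rw [hrefl, Real.cos_two_pi_sub]
    exact key (mod_cast Nat.sub_pos_of_lt hkn) (mod_cast (by omega : 2 * (n - k) ≤ n))

theorem re_le_cos_of_pow_eq_one {z : ℂ} {n : ℕ} [NeZero n] (hz : z ^ n = 1) (hz1 : z ≠ 1) :
    z.re ≤ Real.cos (2 * Real.pi / n) := by
  obtain ⟨k, hkn, rfl⟩ := (isPrimitiveRoot_exp n (NeZero.ne n)).eq_pow_of_pow_eq_one hz
  have hk : k ≠ 0 := by
    rintro rfl
    exact hz1 (pow_zero _)
  have hexp : exp (2 * Real.pi * I / n) ^ k = exp ((2 * Real.pi * (k / n) : ℝ) * I) := by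
    rw [← exp_nat_mul]
    push_cast
    ring_nf
  rw [hexp, exp_ofReal_mul_I_re]
  exact cos_two_pi_mul_div_le hk hkn

variable {G : Type*} [AddCommGroup G] [Fintype G]

open scoped ComplexConjugate in
theorem sum_addChar_mul_norm_sq_eq_card_mul_sum (h : G → ℂ) (d : G) :
    ∑ χ : AddChar G ℂ, χ d * ‖∑ x, χ (-x) * h x‖ ^ 2 =
      Fintype.card G * ∑ x, h (x + d) * conj (h x) := by
  classical
  have expand (χ : AddChar G ℂ) : χ d * ‖∑ x, χ (-x) * h x‖ ^ 2 =
      ∑ y, ∑ x, h x * conj (h y) * χ (y + d - x) := by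
    rw [← mul_conj', map_sum, Finset.sum_mul_sum, Finset.sum_comm]
    simp only [Finset.mul_sum, map_mul, AddChar.map_neg_eq_conj, conj_conj, sub_eq_add_neg,
      AddChar.map_add_eq_mul]
    refine Finset.sum_congr rfl fun y _ => Finset.sum_congr rfl fun x _ => ?_
    ring
  simp only [expand]
  rw [Finset.sum_comm, Finset.mul_sum]
  refine Finset.sum_congr rfl fun y _ => ?_
  rw [Finset.sum_comm]
  simp only [← Finset.mul_sum, AddChar.sum_apply_eq_ite, sub_eq_zero]
  rw [Fintype.sum_eq_single (y + d) fun x hx => by simp [hx.symm]]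
  simp [mul_comm]

theorem sum_re_addChar_mul_norm_sq_eq_card_mul_sum (h : G → ℝ) (d : G) :
    ∑ χ : AddChar G ℂ, (χ d).re * ‖∑ x, χ (-x) * (h x : ℂ)‖ ^ 2 =
      Fintype.card G * ∑ x, h (x + d) * h x := by
  have := congrArg re (sum_addChar_mul_norm_sq_eq_card_mul_sum (fun x => (h x : ℂ)) d)
  simpa only [conj_ofReal, re_sum, ← ofReal_pow, re_mul_ofReal, ← ofReal_mul, ← ofReal_natCast,
    ← ofReal_sum, ofReal_re] using this

theorem sum_mul_add_le_cos_mul_sum_sq {s : G} (hs : AddSubgroup.zmultiples s = ⊤) {h : G → ℝ}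
    (hsum : ∑ x, h x = 0) :
    ∑ x, h (x + s) * h x ≤ Real.cos (2 * Real.pi / Fintype.card G) * ∑ x, h x ^ 2 := by
  have hre (χ : AddChar G ℂ) (hχ : χ ≠ 0) :
      (χ s).re ≤ Real.cos (2 * Real.pi / Fintype.card G) := by
    refine re_le_cos_of_pow_eq_one ?_ fun h1 => hχ ?_
    · rw [← AddChar.map_nsmul_eq_pow, card_nsmul_eq_zero, AddChar.map_zero_eq_one]
    · ext x
      obtain ⟨k, rfl⟩ := AddSubgroup.mem_zmultiples_iff.mp (hs ▸ AddSubgroup.mem_top x)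
      rw [AddChar.map_zsmul_eq_zpow, h1, one_zpow, AddChar.zero_apply]
  refine le_of_mul_le_mul_left ?_ (Nat.cast_pos.mpr (Fintype.card_pos (α := G)) : (0 : ℝ) < _)
  have hparseval := sum_re_addChar_mul_norm_sq_eq_card_mul_sum h 0
  simp only [AddChar.map_zero_eq_one, one_re, one_mul, add_zero, ← sq] at hparseval
  rw [← sum_re_addChar_mul_norm_sq_eq_card_mul_sum, mul_left_comm, ← hparseval, Finset.mul_sum]
  refine Finset.sum_le_sum fun χ _ => ?_
  obtain rfl | hχ := eq_or_ne χ 0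
  · simp [← ofReal_sum, hsum]
  · gcongr
    exact hre χ hχ

end Wirtinger

/-- Solutions `p` and `r` of the eigenvalue equation `f (k - 1) + f (k + 1) = μ f k` in the interior
of a path with vertices `0, …, m`: `p` is positive and symmetric, `r` is antisymmetric, and both are
`1` at the vertex `0`. The values at `k > m` are irrelevant. -/
structure PathProfile (m : ℕ) (μ : ℝ) where
  p : ℕ → ℝ
  r : ℕ → ℝ
  p_pos : ∀ k ≤ m, 0 < p k
  p_zero : p 0 = 1
  r_zero : r 0 = 1
  p_symm : ∀ k ≤ m, p (m - k) = p k
  r_symm : ∀ k ≤ m, r (m - k) = -r k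
  p_rec : ∀ k, k + 2 ≤ m → p k + p (k + 2) = μ * p (k + 1)
  r_rec : ∀ k, k + 2 ≤ m → r k + r (k + 2) = μ * r (k + 1)

namespace PathProfile

/-- The solution of the eigenvalue equation with boundary values `x` and `y`. -/
noncomputable def interp {m : ℕ} {μ : ℝ} (h : PathProfile m μ) (x y : ℝ) (k : ℕ) : ℝ :=
  (x + y) / 2 * h.p k + (x - y) / 2 * h.r k

section Form

variable {M : ℕ} {μ : ℝ} (h : PathProfile (M + 1) μ)

include h

theorem p_last : h.p (M + 1) = 1 := by
  rw [← h.p_symm _ le_rfl, Nat.sub_self, h.p_zero]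

theorem r_last : h.r (M + 1) = -1 := by
  rw [eq_neg_iff_add_eq_zero, ← neg_eq_iff_add_eq_zero, ← h.r_symm _ le_rfl, Nat.sub_self, h.r_zero]

theorem sum_mul_succ_le (f : ℕ → ℝ) :
    2 * ∑ k ∈ Finset.range (M + 1), f k * f (k + 1) ≤
      μ * ∑ k ∈ Finset.range M, f (k + 1) ^ 2 + h.p 1 * (f 0 ^ 2 + f (M + 1) ^ 2) := by
  -- AM-GM with the weights `p (k + 1) / p k`, which telescope by the eigenvalue equation.
  have amgm (k : ℕ) (hk : k < M + 1) : 2 * (f k * f (k + 1)) ≤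
      h.p (k + 1) / h.p k * f k ^ 2 + h.p k / h.p (k + 1) * f (k + 1) ^ 2 := by
    have h0 := h.p_pos k hk.le
    have h1 := h.p_pos (k + 1) hk
    have hsq : h.p (k + 1) / h.p k * f k ^ 2 + h.p k / h.p (k + 1) * f (k + 1) ^ 2 -
        2 * (f k * f (k + 1)) =
        (h.p (k + 1) * f k - h.p k * f (k + 1)) ^ 2 / (h.p k * h.p (k + 1)) := by
      field_simp
      ring
    rw [← sub_nonneg, hsq]
    positivity
  have hfirst : h.p (0 + 1) / h.p 0 = h.p 1 := by rw [h.p_zero, div_one]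
  have hlast : h.p M / h.p (M + 1) = h.p 1 := by
    rw [h.p_last, div_one, ← h.p_symm 1 (by omega), Nat.add_sub_cancel]
  calc 2 * ∑ k ∈ Finset.range (M + 1), f k * f (k + 1)
      ≤ ∑ k ∈ Finset.range (M + 1),
        (h.p (k + 1) / h.p k * f k ^ 2 + h.p k / h.p (k + 1) * f (k + 1) ^ 2) := by
        rw [Finset.mul_sum]
        exact Finset.sum_le_sum fun k hk => amgm k (Finset.mem_range.mp hk)
    _ = ∑ k ∈ Finset.range M, (h.p (k + 2) / h.p (k + 1) * f (k + 1) ^ 2 +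
          h.p k / h.p (k + 1) * f (k + 1) ^ 2) + h.p 1 * (f 0 ^ 2 + f (M + 1) ^ 2) := by
        rw [Finset.sum_add_distrib, Finset.sum_range_succ', Finset.sum_range_succ _ M, hfirst,
          hlast, Finset.sum_add_distrib]
        ring
    _ = _ := by
        rw [Finset.mul_sum]
        congr 1
        refine Finset.sum_congr rfl fun k hk => ?_
        have hk' := Finset.mem_range.mp hk
        have hpos := h.p_pos (k + 1) (by omega)
        have hrec := h.p_rec k (by omega)
        field_simp
        linear_combination f (k + 1) ^ 2 * hrec

theorem interp_zero (x y : ℝ) : h.interp x y 0 = x := by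
  rw [interp, h.p_zero, h.r_zero]
  ring

theorem interp_last (x y : ℝ) : h.interp x y (M + 1) = y := by
  rw [interp, h.p_last, h.r_last]
  ring

theorem sum_interp_mul_succ (x y : ℝ) :
    2 * ∑ k ∈ Finset.range (M + 1), h.interp x y k * h.interp x y (k + 1) =
      μ * ∑ k ∈ Finset.range M, h.interp x y (k + 1) ^ 2 +
        (h.r 1 * (x ^ 2 + y ^ 2) + (h.p 1 - h.r 1) / 2 * (x + y) ^ 2) := by
  set f := h.interp x y with hf
  have hboundary : x * f 1 + f M * y =
      h.r 1 * (x ^ 2 + y ^ 2) + (h.p 1 - h.r 1) / 2 * (x + y) ^ 2 := by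
    have hp : h.p M = h.p 1 := h.p_symm 1 (by omega)
    have hr : h.r M = -h.r 1 := h.r_symm 1 (by omega)
    simp only [hf, interp, hp, hr]
    ring
  have hinner : ∑ k ∈ Finset.range M, (f k * f (k + 1) + f (k + 1) * f (k + 2)) =
      μ * ∑ k ∈ Finset.range M, f (k + 1) ^ 2 := by
    rw [Finset.mul_sum]
    refine Finset.sum_congr rfl fun k hk => ?_
    have hk' : k + 2 ≤ M + 1 := by have := Finset.mem_range.mp hk; omega
    simp only [hf, interp]
    linear_combination ((x + y) / 2 * h.p_rec k hk' + (x - y) / 2 * h.r_rec k hk') *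
      ((x + y) / 2 * h.p (k + 1) + (x - y) / 2 * h.r (k + 1))
  have hf_zero : f 0 = x := h.interp_zero x y
  have hf_last : f (M + 1) = y := h.interp_last x y
  rw [← hboundary, ← hinner, two_mul, Finset.sum_add_distrib]
  nth_rewrite 1 [Finset.sum_range_succ]
  rw [Finset.sum_range_succ', hf_zero, hf_last]
  ring

end Form

section Examples

/-- The profile with `μ = 2` on a path with two edges. -/
noncomputable def two : PathProfile 2 2 where
  p _ := 1
  r k := 1 - k
  p_pos _ _ := one_pos
  p_zero := rfl
  r_zero := by simp
  p_symm _ _ := rfl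
  r_symm k hk := by push_cast [hk]; ring
  p_rec _ _ := by norm_num
  r_rec k _ := by push_cast; ring

theorem pow_add_pow_add_two {β : ℝ} (hβ : β ≠ 0) (k : ℕ) :
    β ^ k + β ^ (k + 2) = (β + β⁻¹) * β ^ (k + 1) := by
  rw [pow_succ β (k + 1), pow_succ]
  field_simp
  ring

theorem pow_sub_add_pow_sub_add_two {m k : ℕ} {β : ℝ} (hβ : β ≠ 0) (hk : k + 2 ≤ m) :
    β ^ (m - k) + β ^ (m - (k + 2)) = (β + β⁻¹) * β ^ (m - (k + 1)) := by
  rw [show m - k = m - (k + 2) + 2 by omega, show m - (k + 1) = m - (k + 2) + 1 by omega,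
    add_comm, pow_add_pow_add_two hβ]

variable {m : ℕ} {β : ℝ}

/-- The profile with `μ = β + β⁻¹`. -/
noncomputable def exponential (hm : m ≠ 0) (hβ : 1 < β) : PathProfile m (β + β⁻¹) where
  p k := (β ^ (m - k) + β ^ k) / (β ^ m + 1)
  r k := (β ^ (m - k) - β ^ k) / (β ^ m - 1)
  p_pos _ _ := by positivity
  p_zero := by
    have : 0 < β ^ m + 1 := by positivity
    simp [this.ne']
  r_zero := by
    have : 0 < β ^ m - 1 := sub_pos.mpr (one_lt_pow₀ hβ hm)
    simp [this.ne']
  p_symm k hk := by rw [Nat.sub_sub_self hk, add_comm (β ^ k)]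
  r_symm k hk := by rw [Nat.sub_sub_self hk, ← neg_div, neg_sub]
  p_rec k hk := by
    rw [← add_div, ← mul_div_assoc, mul_add, ← pow_add_pow_add_two (by positivity) k,
      ← pow_sub_add_pow_sub_add_two (by positivity) hk]
    ring
  r_rec k hk := by
    rw [← add_div, ← mul_div_assoc, mul_sub, ← pow_add_pow_add_two (by positivity) k,
      ← pow_sub_add_pow_sub_add_two (by positivity) hk]
    ring

theorem two_mul_exponential_p_one (hm : m ≠ 0) (hβ : 1 < β) :
    2 * (exponential hm hβ).p 1 =
      β + β⁻¹ - (β - β⁻¹) * ((β ^ m - 1) / (β ^ m + 1)) := by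
  have : 0 < β ^ m + 1 := by positivity
  simp only [exponential]
  rw [pow_sub₀ β (by positivity) (by omega : 1 ≤ m), pow_one]
  field_simp
  ring

theorem two_mul_exponential_r_one (hm : m ≠ 0) (hβ : 1 < β) :
    2 * (exponential hm hβ).r 1 =
      β + β⁻¹ - (β - β⁻¹) / ((β ^ m - 1) / (β ^ m + 1)) := by
  have : 0 < β ^ m + 1 := by positivity
  have : 0 < β ^ m - 1 := sub_pos.mpr (one_lt_pow₀ hβ hm)
  simp only [exponential]
  rw [pow_sub₀ β (by positivity) (by omega : 1 ≤ m), pow_one]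
  field_simp
  ring

end Examples

end PathProfile

section PathLength

open Real

theorem exists_pathProfile_of_three_le {m : ℕ} (hm : 3 ≤ m) :
    ∃ (μ : ℝ) (h : PathProfile m μ), μ ≤ 2 + 2 * h.r 1 ∧ h.r 1 < h.p 1 ∧
      2 * ((2 ^ m - 1) / (2 ^ m + 1)) ^ 2 + 2 * h.p 1 ≤ μ := by
  set τ : ℝ := (2 ^ m - 1) / (2 ^ m + 1) with hτ
  have hτ_ge : 3 / 4 ≤ τ := by
    have : (2 : ℝ) ^ 3 ≤ 2 ^ m := pow_le_pow_right₀ one_le_two hm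
    rw [hτ, div_le_div_iff₀ (by norm_num) (by positivity)]
    linarith
  -- The solution of `β - β⁻¹ = 2 * τ`; it is at least `2`, so that `τ ≤ T` below.
  set β : ℝ := τ + √(1 + τ ^ 2) with hβ
  have hβ_ge : 2 ≤ β := by
    have : 5 / 4 ≤ √(1 + τ ^ 2) := le_sqrt_of_sq_le (by nlinarith)
    linarith
  have hβ_sub : β - β⁻¹ = 2 * τ := by
    have hsqrt : √(1 + τ ^ 2) ^ 2 = 1 + τ ^ 2 := sq_sqrt (by positivity)
    have : β * β - 1 = 2 * τ * β := by
      rw [hβ]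
      linear_combination hsqrt
    field_simp
    linear_combination this
  set T : ℝ := (β ^ m - 1) / (β ^ m + 1) with hT
  have hτT : τ ≤ T := by
    have : (2 : ℝ) ^ m ≤ β ^ m := by gcongr
    rw [hτ, hT, div_le_div_iff₀ (by positivity) (by positivity)]
    linarith
  have hT_lt : T < 1 := by
    rw [hT, div_lt_one (by positivity)]
    linarith
  have hT_pos : 0 < T := by linarith
  have hp := PathProfile.two_mul_exponential_p_one (by omega : m ≠ 0) (by linarith : 1 < β)
  have hr := PathProfile.two_mul_exponential_r_one (by omega : m ≠ 0) (by linarith : 1 < β)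
  rw [hβ_sub, ← hT] at hp hr
  refine ⟨β + β⁻¹, PathProfile.exponential (by omega) (by linarith), ?_, ?_, ?_⟩
  · have : 2 * τ / T ≤ 2 := (div_le_iff₀ hT_pos).mpr (by linarith)
    linarith
  · have : 2 * τ * T < 2 * τ / T := by
      rw [lt_div_iff₀ hT_pos]
      nlinarith [mul_pos hT_pos (sub_pos.mpr hT_lt)]
    linarith
  · nlinarith

theorem cos_two_pi_div_le {x : ℝ} (hx : 5 ≤ x) : cos (2 * π / x) ≤ 1 - 16 / x ^ 2 := by
  have hπ := pi_gt_d4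
  have hx0 : 0 < x := by linarith
  set y := π / x with hy
  have hy_pos : 0 < y := by positivity
  have hyx : y * x = π := div_mul_cancel₀ _ hx0.ne'
  have hy_le : y ≤ 0.62832 := by
    rw [hy, div_le_iff₀ hx0]
    linarith [pi_lt_d4]
  have hsin : 0.9013 * y ≤ sin y := by
    have : y ^ 2 ≤ 0.3948 := by nlinarith
    nlinarith [sin_gt_sub_cube hy_pos]
  have hsin_sq : 8 / x ^ 2 ≤ sin y ^ 2 := by
    calc 8 / x ^ 2 ≤ (0.9013 * y) ^ 2 := by
          rw [div_le_iff₀ (by positivity), ← mul_pow, mul_assoc, hyx]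
          nlinarith
      _ ≤ sin y ^ 2 := by gcongr
  calc cos (2 * π / x) = 1 - 2 * sin y ^ 2 := by
        rw [mul_div_assoc, cos_two_mul, cos_sq']
        ring
    _ ≤ 1 - 2 * (8 / x ^ 2) := by gcongr
    _ = 1 - 16 / x ^ 2 := by ring

variable {q : ℕ}

theorem pathLength_bounds (hq : 4 ≤ q) : 2 ≤ pathLength q ∧
    2 * logb 2 ((q : ℝ) - 1) ≤ pathLength q + 2 ∧
      (pathLength q : ℝ) + 1 < 2 * logb 2 ((q : ℝ) - 1) := by
  have hq' : (4 : ℝ) ≤ q := by exact_mod_cast hq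
  set x := 2 * logb 2 ((q : ℝ) - 1) with hx
  have hx_gt : 3 < x := by
    have : x = logb 2 (((q : ℝ) - 1) ^ 2) := by rw [hx, logb_pow]; norm_num
    rw [this, lt_logb_iff_rpow_lt one_lt_two (by nlinarith)]
    norm_num
    nlinarith
  have hceil : 3 < ⌈x⌉₊ := Nat.lt_ceil.mpr (by exact_mod_cast hx_gt)
  have hm : pathLength q + 2 = ⌈x⌉₊ := Nat.sub_add_cancel (hceil.trans' (by norm_num)).le
  have hm' : (pathLength q : ℝ) + 2 = ⌈x⌉₊ := by exact_mod_cast hm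
  refine ⟨by omega, hm' ▸ Nat.le_ceil x, ?_⟩
  linarith [Nat.ceil_lt_add_one (by linarith : 0 ≤ x)]

theorem sq_le_two_pow_pathLength (hq : 4 ≤ q) : ((q : ℝ) - 1) ^ 2 ≤ 4 * 2 ^ pathLength q := by
  have hq' : (4 : ℝ) ≤ q := by exact_mod_cast hq
  have hlog : 2 * logb 2 ((q : ℝ) - 1) = logb 2 (((q : ℝ) - 1) ^ 2) := by
    rw [logb_pow]
    norm_num
  calc ((q : ℝ) - 1) ^ 2 ≤ 2 ^ ((pathLength q : ℝ) + 2) := by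
        rw [← logb_le_iff_le_rpow one_lt_two (by nlinarith), ← hlog]
        exact (pathLength_bounds hq).2.1
    _ = 4 * 2 ^ pathLength q := by
        rw [rpow_add two_pos, rpow_natCast]
        norm_num
        ring

theorem sqrt_card_div_logb_le (hq : 4 ≤ q) :
    √(((q * (q - 1) * pathLength q : ℕ) : ℝ) /
      logb 2 ((q * (q - 1) * pathLength q : ℕ) : ℝ)) ≤ (q : ℝ) - 1 := by
  obtain ⟨hm, -, hlt⟩ := pathLength_bounds hq
  generalize pathLength q = m at hm hlt
  obtain ⟨k, rfl⟩ : ∃ k, q = k + 1 := ⟨q - 1, by omega⟩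
  push_cast [Nat.add_sub_cancel] at hlt ⊢
  rw [add_sub_cancel_right] at hlt ⊢
  have hk3 : (3 : ℝ) ≤ k := by exact_mod_cast (by omega : 3 ≤ k)
  have hm2 : (2 : ℝ) ≤ m := by exact_mod_cast hm
  have hlogk : logb 2 k ≤ k := by
    rw [logb_le_iff_le_rpow one_lt_two (by positivity), rpow_natCast]
    exact_mod_cast Nat.lt_two_pow_self.le
  have hlog : 2 * logb 2 k + 1 ≤ logb 2 (((k : ℝ) + 1) * k * m) := by
    have : logb 2 k ≤ logb 2 ((k : ℝ) + 1) :=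
      logb_le_logb_of_le one_lt_two (by positivity) (by linarith)
    have : 1 ≤ logb 2 (m : ℝ) := by
      rwa [le_logb_iff_rpow_le one_lt_two (by positivity), rpow_one]
    rw [logb_mul (by positivity) (by positivity), logb_mul (by positivity) (by positivity)]
    linarith
  rw [sqrt_le_left (by positivity), div_le_iff₀ (by linarith)]
  calc ((k : ℝ) + 1) * k * m = k * (m * (k + 1)) := by ring
    _ ≤ k * (k * (2 * logb 2 k + 1)) := by
        refine mul_le_mul_of_nonneg_left ?_ (by positivity)
        nlinarith
    _ ≤ k * (k * logb 2 (((k : ℝ) + 1) * k * m)) := by gcongr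
    _ = _ := by ring

theorem pathLength_le_two (hq : 4 ≤ q) (hq5 : q ≤ 5) : pathLength q ≤ 2 := by
  have hq4' : (4 : ℝ) ≤ q := by exact_mod_cast hq
  have hq5' : (q : ℝ) ≤ 5 := by exact_mod_cast hq5
  have hlog : logb 2 ((q : ℝ) - 1) ≤ 2 := by
    rw [logb_le_iff_le_rpow one_lt_two (by linarith)]
    norm_num
    linarith [hq5']
  have : (pathLength q : ℝ) < 3 := by linarith [(pathLength_bounds hq).2.2]
  exact Nat.lt_succ_iff.mp (by exact_mod_cast this)

theorem cos_two_pi_div_le_sq_of_sq_le {x X : ℝ} (hx : 5 ≤ x) (hX : x ^ 2 ≤ 4 * X) :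
    cos (2 * π / x) ≤ ((X - 1) / (X + 1)) ^ 2 := by
  have hX0 : 0 < X := by nlinarith
  calc cos (2 * π / x) ≤ 1 - 16 / x ^ 2 := cos_two_pi_div_le hx
    _ ≤ 1 - 16 / (4 * X) := by gcongr
    _ ≤ 1 - 4 * X / (X + 1) ^ 2 := by
        rw [sub_le_sub_iff_left, div_le_div_iff₀ (by positivity) (by positivity)]
        nlinarith
    _ = ((X - 1) / (X + 1)) ^ 2 := by
        field_simp
        ring

theorem exists_pathProfile_pathLength (hq : 4 ≤ q) :
    ∃ (μ : ℝ) (h : PathProfile (pathLength q) μ), μ ≤ 2 + 2 * h.r 1 ∧ h.r 1 < h.p 1 ∧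
      2 * cos (2 * π / ((q : ℝ) - 1)) + 2 * h.p 1 ≤ μ := by
  obtain hq5 | hq6 := le_or_gt q 5
  · have hq4' : (4 : ℝ) ≤ q := by exact_mod_cast hq
    have hq5' : (q : ℝ) ≤ 5 := by exact_mod_cast hq5
    rw [(pathLength_le_two hq hq5).antisymm (pathLength_bounds hq).1]
    have hcos : cos (2 * π / ((q : ℝ) - 1)) ≤ 0 := by
      refine cos_nonpos_of_pi_div_two_le_of_le ?_ ?_
      · rw [div_le_div_iff₀ two_pos (by linarith)]
        nlinarith [pi_pos]
      · rw [div_le_iff₀ (by linarith)]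
        nlinarith [pi_pos]
    refine ⟨2, PathProfile.two, ?_, ?_, ?_⟩ <;> simp only [PathProfile.two] <;> norm_num
    linarith
  · have hq6' : (5 : ℝ) ≤ (q : ℝ) - 1 := by
      have : (6 : ℝ) ≤ q := by exact_mod_cast hq6
      linarith
    have hsq := sq_le_two_pow_pathLength hq
    have hm : 3 ≤ pathLength q := by
      by_contra! hlt
      rw [show pathLength q = 2 by linarith [(pathLength_bounds hq).1]] at hsq
      nlinarith
    obtain ⟨μ, h, hr, hrp, hp⟩ := exists_pathProfile_of_three_le hm
    exact ⟨μ, h, hr, hrp, by linarith [cos_two_pi_div_le_sq_of_sq_le hq6' hsq]⟩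

end PathLength

section PathReplacement

variable {V ι : Type*} {a b : ι → V} {m k : ℕ} {i i' : ι}

theorem pathVertex_zero : pathVertex a b m i 0 = Sum.inl (a i) :=
  rfl

theorem pathVertex_eq_inr_iff {j : Fin (m - 1)} :
    pathVertex a b m i k = Sum.inr (i', j) ↔ i = i' ∧ k = j + 1 := by
  have hj := j.isLt
  unfold pathVertex
  split_ifs with h0 h1
  · grind
  · simp only [Sum.inr.injEq, Prod.mk.injEq, Fin.ext_iff]
    grind
  · grind

theorem pathVertex_succ (j : Fin (m - 1)) : pathVertex a b m i (j + 1) = Sum.inr (i, j) :=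
  pathVertex_eq_inr_iff.mpr ⟨rfl, rfl⟩

theorem pathVertex_eq_inl_iff (hm : m ≠ 0) (hk : k ≤ m) {v : V} :
    pathVertex a b m i k = Sum.inl v ↔ k = 0 ∧ a i = v ∨ k = m ∧ b i = v := by
  unfold pathVertex
  split_ifs with h0 h1
  all_goals grind

theorem pathVertex_last (hm : m ≠ 0) : pathVertex a b m i m = Sum.inl (b i) :=
  (pathVertex_eq_inl_iff hm le_rfl).mpr (.inr ⟨rfl, rfl⟩)

theorem exists_pathVertex_eq_inr (hk : k ≠ 0) (hkm : k < m) :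
    ∃ j, pathVertex a b m i k = Sum.inr (i, j) :=
  ⟨⟨k - 1, by omega⟩, pathVertex_eq_inr_iff.mpr ⟨rfl, by simp only; omega⟩⟩

theorem pathVertex_injOn (hm : m ≠ 0) (hab : a i ≠ b i) :
    Set.InjOn (pathVertex a b m i) {k | k ≤ m} := by
  intro k hk l hl hkl
  cases hv : pathVertex a b m i l with
  | inl v =>
    have h1 := (pathVertex_eq_inl_iff hm hk).mp (hkl.trans hv)
    have h2 := (pathVertex_eq_inl_iff hm hl).mp hv
    grind
  | inr p =>
    rw [(pathVertex_eq_inr_iff.mp (hkl.trans hv)).2, (pathVertex_eq_inr_iff.mp hv).2]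

theorem exists_inr_mem_pathEdge (hm : 2 ≤ m) (hk : k < m) :
    ∃ j, Sum.inr (i, j) ∈ s(pathVertex a b m i k, pathVertex a b m i (k + 1)) := by
  obtain rfl | hk0 := eq_or_ne k 0
  · obtain ⟨j, hj⟩ := exists_pathVertex_eq_inr (a := a) (b := b) (i := i) one_ne_zero hm
    exact ⟨j, hj ▸ Sym2.mem_mk_right _ _⟩
  · obtain ⟨j, hj⟩ := exists_pathVertex_eq_inr (a := a) (b := b) (i := i) hk0 hk
    exact ⟨j, hj ▸ Sym2.mem_mk_left _ _⟩

theorem pathVertex_ne_pathVertex_succ (hm : 2 ≤ m) (hk : k < m) :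
    pathVertex a b m i k ≠ pathVertex a b m i (k + 1) := by
  intro h
  obtain ⟨j, hj⟩ := exists_inr_mem_pathEdge (a := a) (b := b) (i := i) hm hk
  rw [← h, Sym2.mem_iff, or_self, eq_comm] at hj
  have := (pathVertex_eq_inr_iff.mp hj).2
  have := (pathVertex_eq_inr_iff.mp (h ▸ hj)).2
  omega

theorem pathEdge_injective (hm : 2 ≤ m) (hab : ∀ i, a i ≠ b i) :
    Function.Injective fun p : ι × Fin m =>
      s(pathVertex a b m p.1 p.2, pathVertex a b m p.1 (p.2 + 1)) := by
  rintro ⟨i, k⟩ ⟨i', l⟩ h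
  obtain rfl : i = i' := by
    obtain ⟨j, hj⟩ := exists_inr_mem_pathEdge (a := a) (b := b) (i := i) hm k.isLt
    simp only at h
    rw [h, Sym2.mem_iff] at hj
    obtain hj | hj := hj <;> exact (pathVertex_eq_inr_iff.mp hj.symm).1.symm
  have hinj := pathVertex_injOn (by omega : m ≠ 0) (hab i)
  have hk := k.isLt
  have hl := l.isLt
  obtain ⟨h1, -⟩ | ⟨h1, h2⟩ := Sym2.eq_iff.mp h
  · exact Prod.ext rfl (Fin.ext (hinj hk.le hl.le h1))
  · have h1 := hinj hk.le hl h1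
    have h2 := hinj hk hl.le h2
    omega

variable {H : SimpleGraph V}

theorem replaceEdgesByPaths_adj (hm : 2 ≤ m) {x y : V ⊕ ι × Fin (m - 1)} :
    (replaceEdgesByPaths H a b m).Adj x y ↔
      (∃ u v, (H.deleteEdges (Set.range fun i => s(a i, b i))).Adj u v ∧
        Sum.inl u = x ∧ Sum.inl v = y) ∨
      ∃ i, ∃ k < m, s(pathVertex a b m i k, pathVertex a b m i (k + 1)) = s(x, y) := by
  rw [replaceEdgesByPaths, SimpleGraph.fromRel_adj]
  constructor
  · rintro ⟨-, (⟨u, v, huv, rfl, rfl⟩ | ⟨i, k, hk, rfl, rfl⟩) |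
      ⟨u, v, huv, rfl, rfl⟩ | ⟨i, k, hk, rfl, rfl⟩⟩
    · exact .inl ⟨u, v, huv, rfl, rfl⟩
    · exact .inr ⟨i, k, hk, rfl⟩
    · exact .inl ⟨v, u, huv.symm, rfl, rfl⟩
    · exact .inr ⟨i, k, hk, Sym2.eq_swap⟩
  · rintro (⟨u, v, huv, rfl, rfl⟩ | ⟨i, k, hk, h⟩)
    · exact ⟨Sum.inl_injective.ne huv.ne, .inl (.inl ⟨u, v, huv, rfl, rfl⟩)⟩
    · have hne := pathVertex_ne_pathVertex_succ (a := a) (b := b) (i := i) hm hk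
      obtain ⟨rfl, rfl⟩ | ⟨rfl, rfl⟩ := Sym2.eq_iff.mp h
      · exact ⟨hne, .inl (.inr ⟨i, k, hk, rfl, rfl⟩)⟩
      · exact ⟨hne.symm, .inr (.inr ⟨i, k, hk, rfl, rfl⟩)⟩

theorem edgeSet_replaceEdgesByPaths (hm : 2 ≤ m) :
    (replaceEdgesByPaths H a b m).edgeSet =
      Sym2.map Sum.inl '' (H.deleteEdges (Set.range fun i => s(a i, b i))).edgeSet ∪
        Set.range fun p : ι × Fin m =>
          s(pathVertex a b m p.1 p.2, pathVertex a b m p.1 (p.2 + 1)) := by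
  ext e
  induction e with | _ x y
  simp only [SimpleGraph.mem_edgeSet, replaceEdgesByPaths_adj hm, Set.mem_union, Set.mem_image,
    Set.mem_range, Prod.exists, Sym2.exists, Sym2.map_mk, Fin.exists_iff, exists_prop]
  refine or_congr_left ⟨?_, ?_⟩
  · rintro ⟨u, v, huv, rfl, rfl⟩
    exact ⟨u, v, huv, rfl⟩
  · rintro ⟨u, v, huv, h⟩
    obtain ⟨rfl, rfl⟩ | ⟨rfl, rfl⟩ := Sym2.eq_iff.mp h
    · exact ⟨u, v, huv, rfl, rfl⟩
    · exact ⟨v, u, huv.symm, rfl, rfl⟩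

theorem replaceEdgesByPaths_connected (hm : 2 ≤ m) (hH : H.Connected) :
    (replaceEdgesByPaths H a b m).Connected := by
  set G := replaceEdgesByPaths H a b m
  have reachable_pathVertex (i : ι) {k : ℕ} (hk : k ≤ m) :
      G.Reachable (Sum.inl (a i)) (pathVertex a b m i k) := by
    induction k with
    | zero => rfl
    | succ k ih =>
      exact (ih (by omega)).trans
        ((replaceEdgesByPaths_adj hm).mpr (.inr ⟨i, k, by omega, rfl⟩)).reachable
  have reachable_last (i : ι) : G.Reachable (Sum.inl (a i)) (Sum.inl (b i)) := by
    have h := reachable_pathVertex i le_rfl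
    rwa [pathVertex_last (by omega)] at h
  have reachable_of_adj {u v : V} (huv : H.Adj u v) : G.Reachable (Sum.inl u) (Sum.inl v) := by
    by_cases hr : s(u, v) ∈ Set.range fun i => s(a i, b i)
    · obtain ⟨i, hi⟩ := hr
      obtain ⟨rfl, rfl⟩ | ⟨rfl, rfl⟩ := Sym2.eq_iff.mp hi
      · exact reachable_last i
      · exact (reachable_last i).symm
    · exact ((replaceEdgesByPaths_adj hm).mpr (.inl
        ⟨u, v, SimpleGraph.deleteEdges_adj.mpr ⟨huv, hr⟩, rfl, rfl⟩)).reachable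
  have reachable_inl (u v : V) : G.Reachable (Sum.inl u) (Sum.inl v) := by
    obtain ⟨w⟩ := hH u v
    induction w with
    | nil => rfl
    | cons h _ ih => exact (reachable_of_adj h).trans ih
  obtain ⟨v₀⟩ := hH.nonempty
  refine SimpleGraph.connected_iff_exists_forall_reachable _ |>.mpr ⟨Sum.inl v₀, ?_⟩
  rintro (v | ⟨i, j⟩)
  · exact reachable_inl v₀ v
  · rw [← pathVertex_succ j]
    exact (reachable_inl v₀ (a i)).trans (reachable_pathVertex i (by omega))

theorem replaceEdgesByPaths_adj_inl_inl (hm : 2 ≤ m) {u v : V} :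
    (replaceEdgesByPaths H a b m).Adj (Sum.inl u) (Sum.inl v) ↔
      (H.deleteEdges (Set.range fun i => s(a i, b i))).Adj u v := by
  rw [replaceEdgesByPaths_adj hm]
  refine ⟨?_, fun h => .inl ⟨u, v, h, rfl, rfl⟩⟩
  rintro (⟨u, v, huv, ⟨⟩, ⟨⟩⟩ | ⟨i, k, hk, h⟩)
  · exact huv
  · obtain ⟨j, hj⟩ := exists_inr_mem_pathEdge (a := a) (b := b) (i := i) hm hk
    simp [h] at hj

theorem replaceEdgesByPaths_adj_inl_inr (hm : 2 ≤ m) {u : V} {j : Fin (m - 1)} :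
    (replaceEdgesByPaths H a b m).Adj (Sum.inl u) (Sum.inr (i, j)) ↔
      a i = u ∧ (j : ℕ) = 0 ∨ b i = u ∧ (j : ℕ) + 2 = m := by
  have hm0 : m ≠ 0 := by omega
  simp only [replaceEdgesByPaths_adj hm, reduceCtorEq, and_false, exists_false, false_or,
    Sym2.eq_iff, pathVertex_eq_inr_iff]
  constructor
  · rintro ⟨_, k, hk, ⟨hu, rfl, hkj⟩ | ⟨⟨rfl, hkj⟩, hu⟩⟩
    · rw [pathVertex_eq_inl_iff hm0 hk.le] at hu
      grind
    · rw [pathVertex_eq_inl_iff hm0 hk] at hu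
      grind
  · rintro (⟨rfl, hj⟩ | ⟨rfl, hj⟩)
    · exact ⟨i, 0, by omega, .inl ⟨pathVertex_zero, rfl, by omega⟩⟩
    · refine ⟨i, j + 1, by omega, .inr ⟨⟨rfl, rfl⟩, ?_⟩⟩
      rw [add_assoc, one_add_one_eq_two, hj, pathVertex_last hm0]

theorem replaceEdgesByPaths_adj_inr (hm : 2 ≤ m) {j : Fin (m - 1)} {y : V ⊕ ι × Fin (m - 1)}
    (h : (replaceEdgesByPaths H a b m).Adj (Sum.inr (i, j)) y) :
    y = pathVertex a b m i j ∨ y = pathVertex a b m i (j + 2) := by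
  obtain ⟨u, v, -, ⟨⟩, -⟩ | ⟨i, k, hk, h⟩ := (replaceEdgesByPaths_adj hm).mp h
  obtain ⟨hx, rfl⟩ | ⟨rfl, hx⟩ := Sym2.eq_iff.mp h
  · obtain ⟨rfl, rfl⟩ := pathVertex_eq_inr_iff.mp hx
    exact .inr rfl
  · obtain ⟨rfl, hk⟩ := pathVertex_eq_inr_iff.mp hx
    exact .inl (by rw [Nat.succ_injective hk])

section Degree

variable [Fintype V] [Fintype ι]

theorem degree_replaceEdgesByPaths_inr_le (hm : 2 ≤ m)
    [DecidableRel (replaceEdgesByPaths H a b m).Adj] (p : ι × Fin (m - 1)) :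
    (replaceEdgesByPaths H a b m).degree (Sum.inr p) ≤ 2 := by
  classical
  obtain ⟨i, j⟩ := p
  rw [← SimpleGraph.card_neighborFinset_eq_degree]
  refine (Finset.card_le_card (t := {pathVertex a b m i j, pathVertex a b m i (j + 2)})
    fun y hy => ?_).trans Finset.card_le_two
  rw [Finset.mem_insert, Finset.mem_singleton]
  exact replaceEdgesByPaths_adj_inr hm ((SimpleGraph.mem_neighborFinset _ _ _).mp hy)

theorem degree_replaceEdgesByPaths_inl [DecidableEq V] (hm : 2 ≤ m) (hab : ∀ i, a i ≠ b i)
    [DecidableRel (replaceEdgesByPaths H a b m).Adj]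
    [DecidableRel (H.deleteEdges (Set.range fun i => s(a i, b i))).Adj] (v : V) :
    (replaceEdgesByPaths H a b m).degree (Sum.inl v) =
      (H.deleteEdges (Set.range fun i => s(a i, b i))).degree v +
        (Finset.univ.filter (a · = v)).card + (Finset.univ.filter (b · = v)).card := by
  let first (i : ι) : ι × Fin (m - 1) := (i, ⟨0, by omega⟩)
  let last (i : ι) : ι × Fin (m - 1) := (i, ⟨m - 2, by omega⟩)
  have hfirst : Function.Injective first := fun _ _ h => congrArg Prod.fst h
  have hlast : Function.Injective last := fun _ _ h => congrArg Prod.fst h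
  have hdisj : Disjoint ((Finset.univ.filter (a · = v)).map ⟨first, hfirst⟩)
      ((Finset.univ.filter (b · = v)).map ⟨last, hlast⟩) := by
    simp only [Finset.disjoint_left, Finset.mem_map, Finset.mem_filter]
    rintro _ ⟨i, ⟨-, ha⟩, rfl⟩ ⟨i', ⟨-, hb⟩, h⟩
    obtain rfl : i' = i := congrArg Prod.fst h
    exact hab i' (ha.trans hb.symm)
  have hneighbor : (replaceEdgesByPaths H a b m).neighborFinset (Sum.inl v) =
      ((H.deleteEdges (Set.range fun i => s(a i, b i))).neighborFinset v).disjSum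
        (((Finset.univ.filter (a · = v)).map ⟨first, hfirst⟩).disjUnion
          ((Finset.univ.filter (b · = v)).map ⟨last, hlast⟩) hdisj) := by
    ext (u | ⟨i, j⟩)
    · rw [SimpleGraph.mem_neighborFinset, replaceEdgesByPaths_adj_inl_inl hm,
        Finset.inl_mem_disjSum, SimpleGraph.mem_neighborFinset]
    · simp only [SimpleGraph.mem_neighborFinset, replaceEdgesByPaths_adj_inl_inr hm,
        Finset.inr_mem_disjSum, Finset.mem_disjUnion, Finset.mem_map, Finset.mem_filter,
        Finset.mem_univ, true_and, Function.Embedding.coeFn_mk, first, last, Prod.mk.injEq,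
        Fin.ext_iff]
      grind
  rw [← SimpleGraph.card_neighborFinset_eq_degree, hneighbor, Finset.card_disjSum,
    Finset.card_disjUnion, Finset.card_map, Finset.card_map,
    SimpleGraph.card_neighborFinset_eq_degree, add_assoc]

end Degree

end PathReplacement

section QuadraticForm

namespace PathProfile

variable {V ι : Type*} {a b : ι → V} {m M : ℕ} {μ : ℝ}

/-- The extension of a function on `V` to the new vertices by solutions of the eigenvalue
equation. -/
noncomputable def interpolant (h : PathProfile m μ) (a b : ι → V) :
    (V → ℝ) →ₗ[ℝ] V ⊕ ι × Fin (m - 1) → ℝ where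
  toFun φ := Sum.elim φ fun p => h.interp (φ (a p.1)) (φ (b p.1)) (p.2 + 1)
  map_add' φ ψ := by
    ext (v | p)
    · rfl
    · simp only [Sum.elim_inr, Pi.add_apply, interp]
      ring
  map_smul' c φ := by
    ext (v | p)
    · rfl
    · simp only [Sum.elim_inr, Pi.smul_apply, interp, smul_eq_mul, RingHom.id_apply]
      ring

theorem interpolant_inl (h : PathProfile m μ) (φ : V → ℝ) (v : V) :
    h.interpolant a b φ (Sum.inl v) = φ v :=
  rfl

theorem interpolant_injective (h : PathProfile m μ) (a b : ι → V) :
    Function.Injective (h.interpolant a b) :=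
  fun _ _ hφψ => funext fun v => congrFun hφψ (Sum.inl v)

theorem interpolant_pathVertex (h : PathProfile (M + 1) μ) (φ : V → ℝ) (i : ι) {k : ℕ}
    (hk : k ≤ M + 1) :
    h.interpolant a b φ (pathVertex a b (M + 1) i k) = h.interp (φ (a i)) (φ (b i)) k := by
  obtain rfl | hk0 := eq_or_ne k 0
  · rw [pathVertex_zero, h.interp_zero, interpolant_inl]
  obtain rfl | hkm := hk.eq_or_lt
  · rw [pathVertex_last hk0, h.interp_last, interpolant_inl]
  · obtain ⟨j, hj⟩ := exists_pathVertex_eq_inr (a := a) (b := b) (i := i) hk0 hkm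
    rw [hj, (pathVertex_eq_inr_iff.mp hj).2]
    rfl

end PathProfile

open Matrix

theorem dotProduct_adjMatrix_mulVec_self {V R : Type*} [Fintype V] [CommSemiring R]
    (G : SimpleGraph V) [DecidableRel G.Adj] [Fintype G.edgeSet] (f : V → R) :
    f ⬝ᵥ G.adjMatrix R *ᵥ f = 2 * ∑ e ∈ G.edgeFinset, (e.map f).mul := by
  classical
  have hfst : f ⬝ᵥ G.adjMatrix R *ᵥ f = ∑ d : G.Dart, f d.fst * f d.snd := by
    rw [← Finset.sum_fiberwise _ (fun d : G.Dart => d.fst)]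
    refine Finset.sum_congr rfl fun v _ => ?_
    rw [G.dart_fst_fiber v, Finset.sum_image (G.dartOfNeighborSet_injective v).injOn,
      G.adjMatrix_mulVec_apply, Finset.mul_sum, ← Finset.sum_coe_sort]
    exact Fintype.sum_equiv (Equiv.subtypeEquivRight fun w => G.mem_neighborFinset v w) _ _
      fun _ => rfl
  rw [hfst, Finset.mul_sum, ← Finset.sum_fiberwise_of_maps_to (g := SimpleGraph.Dart.edge)
    fun d _ => SimpleGraph.mem_edgeFinset.mpr d.edge_mem]
  refine Finset.sum_congr rfl fun e he => ?_
  induction e with | _ v w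
  let d : G.Dart := ⟨(v, w), SimpleGraph.mem_edgeFinset.mp he⟩
  rw [show s(v, w) = d.edge from rfl, d.edge_fiber, Finset.sum_pair d.symm_ne.symm, two_mul]
  exact congrArg _ (mul_comm _ _)

variable {V ι R : Type*} [Fintype V] [Fintype ι] {a b : ι → V} {H : SimpleGraph V} {m M : ℕ}

theorem dotProduct_self_eq_add_sum_pathVertex [Semiring R] (a b : ι → V)
    (f : V ⊕ ι × Fin (M + 1 - 1) → R) :
    f ⬝ᵥ f = (f ∘ Sum.inl) ⬝ᵥ (f ∘ Sum.inl) +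
      ∑ i, ∑ k ∈ Finset.range M, f (pathVertex a b (M + 1) i (k + 1)) ^ 2 := by
  simp only [dotProduct, Fintype.sum_sum_type, Fintype.sum_prod_type, Function.comp_apply,
    Finset.sum_range, sq]
  congr! 5 with i _ j _ <;> exact (pathVertex_succ (a := a) (b := b) j).symm

theorem dotProduct_adjMatrix_mulVec_replaceEdgesByPaths [CommSemiring R] (hm : 2 ≤ m)
    (hab : ∀ i, a i ≠ b i) [DecidableRel (replaceEdgesByPaths H a b m).Adj]
    [DecidableRel (H.deleteEdges (Set.range fun i => s(a i, b i))).Adj]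
    (f : V ⊕ ι × Fin (m - 1) → R) :
    f ⬝ᵥ (replaceEdgesByPaths H a b m).adjMatrix R *ᵥ f =
      (f ∘ Sum.inl) ⬝ᵥ
          (H.deleteEdges (Set.range fun i => s(a i, b i))).adjMatrix R *ᵥ (f ∘ Sum.inl) +
        ∑ i, 2 * ∑ k ∈ Finset.range m,
          f (pathVertex a b m i k) * f (pathVertex a b m i (k + 1)) := by
  classical
  let oldEdge : Sym2 V ↪ Sym2 (V ⊕ ι × Fin (m - 1)) :=
    ⟨Sym2.map Sum.inl, Sym2.map.injective Sum.inl_injective⟩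
  let pathEdge : ι × Fin m ↪ Sym2 (V ⊕ ι × Fin (m - 1)) := ⟨_, pathEdge_injective hm hab⟩
  have hdisj : Disjoint
      ((H.deleteEdges (Set.range fun i => s(a i, b i))).edgeFinset.map oldEdge)
      (Finset.univ.map pathEdge) := by
    simp only [Finset.disjoint_left, Finset.mem_map, Finset.mem_univ, true_and]
    rintro _ ⟨e, -, rfl⟩ ⟨⟨i, k⟩, h⟩
    obtain ⟨j, hj⟩ := exists_inr_mem_pathEdge (a := a) (b := b) (i := i) hm k.isLt
    rw [show s(_, _) = Sym2.map Sum.inl e from h, Sym2.mem_map] at hj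
    simp at hj
  have hedges : (replaceEdgesByPaths H a b m).edgeFinset =
      ((H.deleteEdges (Set.range fun i => s(a i, b i))).edgeFinset.map oldEdge).disjUnion
        (Finset.univ.map pathEdge) hdisj := by
    rw [← Finset.coe_inj, SimpleGraph.coe_edgeFinset, Finset.coe_disjUnion, Finset.coe_map,
      Finset.coe_map, SimpleGraph.coe_edgeFinset, Finset.coe_univ, Set.image_univ]
    exact edgeSet_replaceEdgesByPaths hm
  rw [dotProduct_adjMatrix_mulVec_self, dotProduct_adjMatrix_mulVec_self, hedges,
    Finset.sum_disjUnion, Finset.sum_map, Finset.sum_map, Fintype.sum_prod_type, mul_add,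
    Finset.mul_sum Finset.univ]
  congr 2
  · exact Finset.sum_congr rfl fun e _ => congrArg Sym2.mul (Sym2.map_map e)
  · funext i
    rw [Finset.sum_range]
    rfl

namespace PathProfile

variable {μ : ℝ}

theorem dotProduct_adjMatrix_mulVec_le (h : PathProfile m μ) (hm : 2 ≤ m) (hab : ∀ i, a i ≠ b i)
    [DecidableRel (replaceEdgesByPaths H a b m).Adj]
    [DecidableRel (H.deleteEdges (Set.range fun i => s(a i, b i))).Adj]
    (f : V ⊕ ι × Fin (m - 1) → ℝ) :
    f ⬝ᵥ (replaceEdgesByPaths H a b m).adjMatrix ℝ *ᵥ f ≤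
      (f ∘ Sum.inl) ⬝ᵥ
          (H.deleteEdges (Set.range fun i => s(a i, b i))).adjMatrix ℝ *ᵥ (f ∘ Sum.inl) +
        h.p 1 * ∑ i, (f (Sum.inl (a i)) ^ 2 + f (Sum.inl (b i)) ^ 2) +
        μ * (f ⬝ᵥ f - (f ∘ Sum.inl) ⬝ᵥ (f ∘ Sum.inl)) := by
  obtain ⟨M, rfl⟩ : ∃ M, m = M + 1 := ⟨m - 1, by omega⟩
  rw [dotProduct_adjMatrix_mulVec_replaceEdgesByPaths hm hab, add_assoc,
    dotProduct_self_eq_add_sum_pathVertex a b, add_sub_cancel_left, Finset.mul_sum, Finset.mul_sum,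
    ← Finset.sum_add_distrib]
  gcongr with i
  have hpath := h.sum_mul_succ_le fun k => f (pathVertex a b (M + 1) i k)
  rwa [pathVertex_zero, pathVertex_last M.succ_ne_zero, add_comm _ (h.p 1 * _)] at hpath

theorem dotProduct_adjMatrix_mulVec_interpolant (h : PathProfile m μ) (hm : 2 ≤ m)
    (hab : ∀ i, a i ≠ b i) [DecidableRel (replaceEdgesByPaths H a b m).Adj]
    [DecidableRel (H.deleteEdges (Set.range fun i => s(a i, b i))).Adj] (φ : V → ℝ) :
    h.interpolant a b φ ⬝ᵥ
        (replaceEdgesByPaths H a b m).adjMatrix ℝ *ᵥ h.interpolant a b φ =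
      φ ⬝ᵥ (H.deleteEdges (Set.range fun i => s(a i, b i))).adjMatrix ℝ *ᵥ φ +
        (h.r 1 * ∑ i, (φ (a i) ^ 2 + φ (b i) ^ 2) +
          (h.p 1 - h.r 1) / 2 * ∑ i, (φ (a i) + φ (b i)) ^ 2) +
        μ * (h.interpolant a b φ ⬝ᵥ h.interpolant a b φ - φ ⬝ᵥ φ) := by
  obtain ⟨M, rfl⟩ : ∃ M, m = M + 1 := ⟨m - 1, by omega⟩
  have hinl : h.interpolant a b φ ∘ Sum.inl = φ := rfl
  rw [dotProduct_adjMatrix_mulVec_replaceEdgesByPaths hm hab, add_assoc,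
    dotProduct_self_eq_add_sum_pathVertex a b, hinl, add_sub_cancel_left, Finset.mul_sum,
    Finset.mul_sum, Finset.mul_sum, ← Finset.sum_add_distrib, ← Finset.sum_add_distrib]
  congr 1
  refine Finset.sum_congr rfl fun i _ => ?_
  rw [add_comm (h.r 1 * _ + _)]
  convert h.sum_interp_mul_succ (φ (a i)) (φ (b i)) using 3 with k hk
  · have hk := Finset.mem_range.mp hk
    rw [h.interpolant_pathVertex _ _ hk.le, h.interpolant_pathVertex _ _ hk]
  · refine Finset.sum_congr rfl fun k hk => ?_
    rw [h.interpolant_pathVertex _ _ (Nat.succ_le_succ (Finset.mem_range.mp hk).le)]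

end PathProfile

end QuadraticForm

section Cayley

variable {Γ : Type*} [Group Γ]

theorem mulCayley_connected {S : Set Γ} (hS : Subgroup.closure S = ⊤) :
    (SimpleGraph.mulCayley S).Connected := by
  have reachable_mul {g x : Γ} (hx : x ∈ S) : (SimpleGraph.mulCayley S).Reachable g (g * x) := by
    by_cases h : g = g * x
    · rw [← h]
    · exact SimpleGraph.Adj.reachable
        ((SimpleGraph.mulCayley_adj S _ _).mpr ⟨h, .inl (by rwa [inv_mul_cancel_left])⟩)
  refine SimpleGraph.connected_iff_exists_forall_reachable _ |>.mpr ⟨1, fun g => ?_⟩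
  have hg : g ∈ Subgroup.closure S := hS ▸ Subgroup.mem_top g
  induction hg using Subgroup.closure_induction_right with
  | one => rfl
  | mul_right g _ x hx ih => exact ih.trans (reachable_mul hx)
  | mul_inv_cancel g _ x hx ih =>
    have h := reachable_mul (g := g * x⁻¹) hx
    rw [inv_mul_cancel_right] at h
    exact ih.trans h.symm

variable {σ t : Γ}

theorem deleteEdges_mulCayley (hσt : σ ≠ t) (hσt' : σ ≠ t⁻¹) :
    (SimpleGraph.mulCayley ({σ, σ⁻¹, t, t⁻¹} : Set Γ)).deleteEdges
      (Set.range fun g => s(g, g * t)) = SimpleGraph.mulCayley {σ} := by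
  ext u v
  have hrange : s(u, v) ∈ Set.range (fun g => s(g, g * t)) ↔ u⁻¹ * v = t ∨ v⁻¹ * u = t := by
    simp only [Set.mem_range, Sym2.eq_iff, inv_mul_eq_iff_eq_mul]
    constructor
    · rintro ⟨g, ⟨rfl, h⟩ | ⟨rfl, h⟩⟩
      exacts [.inl h.symm, .inr h.symm]
    · rintro (h | h)
      exacts [⟨u, .inl ⟨rfl, h.symm⟩⟩, ⟨v, .inr ⟨rfl, h.symm⟩⟩]
  rw [SimpleGraph.deleteEdges_adj, SimpleGraph.mulCayley_adj, SimpleGraph.mulCayley_adj, hrange,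
    show v⁻¹ * u = (u⁻¹ * v)⁻¹ by group]
  clear hrange
  simp only [Set.mem_insert_iff, Set.mem_singleton_iff, inv_eq_iff_eq_inv, inv_inv]
  grind [inv_inv]

open Matrix

variable [Fintype Γ]

theorem neighborFinset_mulCayley_singleton [DecidableEq Γ] (hσ : σ ≠ 1)
    [DecidableRel (SimpleGraph.mulCayley {σ}).Adj] (g : Γ) :
    (SimpleGraph.mulCayley {σ}).neighborFinset g = {g * σ, g * σ⁻¹} := by
  ext h
  simp only [SimpleGraph.mem_neighborFinset, SimpleGraph.mulCayley_adj, Set.mem_singleton_iff,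
    Finset.mem_insert, Finset.mem_singleton, inv_mul_eq_iff_eq_mul, eq_mul_inv_iff_mul_eq]
  grind [mul_eq_left]

theorem degree_mulCayley_singleton (hσ : σ ≠ σ⁻¹) [DecidableRel (SimpleGraph.mulCayley {σ}).Adj]
    (g : Γ) : (SimpleGraph.mulCayley {σ}).degree g = 2 := by
  classical
  have hσ1 : σ ≠ 1 := by rintro rfl; exact hσ inv_one.symm
  rw [← SimpleGraph.card_neighborFinset_eq_degree, neighborFinset_mulCayley_singleton hσ1,
    Finset.card_pair ((mul_right_injective g).ne hσ)]

theorem dotProduct_adjMatrix_mulVec_mulCayley_singleton {R : Type*} [CommSemiring R] (hσ : σ ≠ σ⁻¹)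
    [DecidableRel (SimpleGraph.mulCayley {σ}).Adj] (φ : Γ → R) :
    φ ⬝ᵥ (SimpleGraph.mulCayley {σ}).adjMatrix R *ᵥ φ = 2 * ∑ g, φ g * φ (g * σ) := by
  classical
  have hσ1 : σ ≠ 1 := by rintro rfl; exact hσ inv_one.symm
  have hinv : ∑ g, φ g * φ (g * σ⁻¹) = ∑ g, φ g * φ (g * σ) := by
    rw [← Equiv.sum_comp (Equiv.mulRight σ)]
    exact Fintype.sum_congr _ _ fun g => by
      rw [Equiv.coe_mulRight, mul_inv_cancel_right, mul_comm]
  simp only [dotProduct, SimpleGraph.adjMatrix_mulVec_apply, neighborFinset_mulCayley_singleton hσ1,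
    Finset.sum_pair ((mul_right_injective _).ne hσ), mul_add, Finset.sum_add_distrib, hinv, two_mul]

end Cayley

section CayleyPathGraph

open Matrix SimpleGraph

variable {Γ : Type*} [Group Γ] {σ t : Γ} {m : ℕ}

/-- The graph of `affinePathGraph` for an arbitrary group `Γ`: the edges `{g, g t}` of the Cayley
graph with generators `σ, σ⁻¹, t, t⁻¹` are replaced by paths of `m` edges. -/
abbrev cayleyPathGraph (σ t : Γ) (m : ℕ) : SimpleGraph (Γ ⊕ Γ × Fin (m - 1)) :=
  replaceEdgesByPaths (mulCayley {σ, σ⁻¹, t, t⁻¹}) (fun g => g) (fun g => g * t) m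

theorem cayleyPathGraph_connected (hm : 2 ≤ m)
    (hΓ : Subgroup.closure {σ, σ⁻¹, t, t⁻¹} = ⊤) : (cayleyPathGraph σ t m).Connected :=
  replaceEdgesByPaths_connected hm (mulCayley_connected hΓ)

variable [Fintype Γ]

theorem graphMaxDegree_cayleyPathGraph (hm : 2 ≤ m) (hσ : σ ≠ σ⁻¹) (ht : t ≠ 1) (hσt : σ ≠ t)
    (hσt' : σ ≠ t⁻¹) : graphMaxDegree (cayleyPathGraph σ t m) = 4 := by
  classical
  have degree_inl (g : Γ) : (cayleyPathGraph σ t m).degree (Sum.inl g) = 4 := by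
    have hdelete : ((mulCayley {σ, σ⁻¹, t, t⁻¹}).deleteEdges
        (Set.range fun g => s(g, g * t))).degree g = 2 := by
      convert degree_mulCayley_singleton hσ g using 2
      exact deleteEdges_mulCayley hσt hσt'
    have hsource : (Finset.univ.filter fun g' => g' = g) = {g} := by
      ext g'
      simp
    have htarget : (Finset.univ.filter fun g' => g' * t = g) = {g * t⁻¹} := by
      ext g'
      simp [eq_mul_inv_iff_mul_eq]
    unfold cayleyPathGraph
    rw [degree_replaceEdgesByPaths_inl hm fun g => (mul_ne_left.mpr ht).symm, hdelete, hsource,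
      htarget, Finset.card_singleton, Finset.card_singleton]
  refine le_antisymm (maxDegree_le_of_forall_degree_le _ _ ?_) ?_
  · rintro (g | p)
    · exact (degree_inl g).le
    · exact (degree_replaceEdgesByPaths_inr_le hm p).trans (by norm_num)
  · rw [← degree_inl 1]
    exact degree_le_maxDegree _ _

theorem card_sum_prod_fin_sub_one {V : Type*} [Fintype V] (hm : m ≠ 0) :
    Fintype.card (V ⊕ V × Fin (m - 1)) = Fintype.card V * m := by
  obtain ⟨M, rfl⟩ := Nat.exists_eq_succ_of_ne_zero hm
  rw [Fintype.card_sum, Fintype.card_prod, Fintype.card_fin, Nat.succ_sub_one, Nat.mul_succ,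
    add_comm]

end CayleyPathGraph

section CayleyPathGraphForm

open Matrix SimpleGraph

variable {Γ : Type*} [Group Γ] [Fintype Γ] {σ t : Γ} {m : ℕ} {μ : ℝ}

theorem dotProduct_adjMatrix_mulVec_deleteEdges_mulCayley {R : Type*} [CommSemiring R]
    (hσ : σ ≠ σ⁻¹) (hσt : σ ≠ t) (hσt' : σ ≠ t⁻¹)
    [DecidableRel ((mulCayley ({σ, σ⁻¹, t, t⁻¹} : Set Γ)).deleteEdges
      (Set.range fun g => s(g, g * t))).Adj] (φ : Γ → R) :
    φ ⬝ᵥ ((mulCayley {σ, σ⁻¹, t, t⁻¹}).deleteEdges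
      (Set.range fun g => s(g, g * t))).adjMatrix R *ᵥ φ = 2 * ∑ g, φ g * φ (g * σ) := by
  classical
  convert dotProduct_adjMatrix_mulVec_mulCayley_singleton hσ φ using 4
  exact deleteEdges_mulCayley hσt hσt'

theorem sum_sq_add_sq_mul_right (t : Γ) (φ : Γ → ℝ) :
    ∑ g, (φ g ^ 2 + φ (g * t) ^ 2) = 2 * φ ⬝ᵥ φ := by
  have htranslate : ∑ g, φ (g * t) ^ 2 = ∑ g, φ g ^ 2 :=
    Equiv.sum_comp (Equiv.mulRight t) fun g => φ g ^ 2
  rw [Finset.sum_add_distrib, htranslate, ← two_mul]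
  simp only [dotProduct, sq]

namespace PathProfile

theorem dotProduct_adjMatrix_mulVec_cayleyPathGraph_le (h : PathProfile m μ) (hm : 2 ≤ m)
    (hσ : σ ≠ σ⁻¹) (ht : t ≠ 1) (hσt : σ ≠ t) (hσt' : σ ≠ t⁻¹)
    [DecidableRel (cayleyPathGraph σ t m).Adj] {c : ℝ} (hμ : 2 * c + 2 * h.p 1 ≤ μ)
    {f : Γ ⊕ Γ × Fin (m - 1) → ℝ}
    (hc : ∑ g, f (Sum.inl g) * f (Sum.inl (g * σ)) ≤ c * ∑ g, f (Sum.inl g) ^ 2) :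
    f ⬝ᵥ (cayleyPathGraph σ t m).adjMatrix ℝ *ᵥ f ≤ μ * f ⬝ᵥ f := by
  classical
  have hform := h.dotProduct_adjMatrix_mulVec_le (H := mulCayley {σ, σ⁻¹, t, t⁻¹})
    (a := fun g => g) (b := fun g => g * t) hm (fun g => (mul_ne_left.mpr ht).symm) f
  have hsq : ∑ g, f (Sum.inl g) ^ 2 = (f ∘ Sum.inl) ⬝ᵥ (f ∘ Sum.inl) := by
    simp only [dotProduct, sq, Function.comp_apply]
  have hsum := sum_sq_add_sq_mul_right t (f ∘ Sum.inl)
  simp only [Function.comp_apply] at hsum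
  rw [dotProduct_adjMatrix_mulVec_deleteEdges_mulCayley hσ hσt hσt', hsum] at hform
  simp only [Function.comp_apply] at hform
  have hnonneg : 0 ≤ ∑ g, f (Sum.inl g) ^ 2 := Finset.sum_nonneg fun g _ => sq_nonneg _
  rw [hsq] at hc hnonneg
  linarith [mul_le_mul_of_nonneg_right hμ hnonneg]

theorem lt_dotProduct_adjMatrix_mulVec_interpolant_cayleyPathGraph (h : PathProfile m μ)
    (hm : 2 ≤ m) (hσ : σ ≠ σ⁻¹) (ht : t ≠ 1) (hσt : σ ≠ t) (hσt' : σ ≠ t⁻¹)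
    [DecidableRel (cayleyPathGraph σ t m).Adj] (hμ : μ ≤ 2 + 2 * h.r 1) (hrp : h.r 1 < h.p 1)
    {φ : Γ → ℝ} (hφσ : ∀ g, φ (g * σ) = φ g) (hφt : ∃ g, φ g + φ (g * t) ≠ 0) :
    μ * h.interpolant (fun g => g) (fun g => g * t) φ ⬝ᵥ
        h.interpolant (fun g => g) (fun g => g * t) φ <
      h.interpolant (fun g => g) (fun g => g * t) φ ⬝ᵥ
        (cayleyPathGraph σ t m).adjMatrix ℝ *ᵥ
          h.interpolant (fun g => g) (fun g => g * t) φ := by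
  classical
  have hform := h.dotProduct_adjMatrix_mulVec_interpolant (H := mulCayley {σ, σ⁻¹, t, t⁻¹})
    (a := fun g => g) (b := fun g => g * t) hm (fun g => (mul_ne_left.mpr ht).symm) φ
  have hcycles : ∑ g, φ g * φ (g * σ) = φ ⬝ᵥ φ := by simp only [hφσ, dotProduct]
  rw [dotProduct_adjMatrix_mulVec_deleteEdges_mulCayley hσ hσt hσt', sum_sq_add_sq_mul_right t,
    hcycles] at hform
  have hnonneg : 0 ≤ φ ⬝ᵥ φ := Finset.sum_nonneg fun g _ => mul_self_nonneg _
  have hpos : 0 < ∑ g, (φ g + φ (g * t)) ^ 2 := by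
    obtain ⟨g, hg⟩ := hφt
    exact Finset.sum_pos' (fun g _ => sq_nonneg _) ⟨g, Finset.mem_univ g, by positivity⟩
  rw [hform]
  linarith [mul_le_mul_of_nonneg_right hμ hnonneg, mul_pos (half_pos (sub_pos.mpr hrp)) hpos]

end PathProfile

end CayleyPathGraphForm

section Symmetry

open Matrix SimpleGraph

section Replacement

variable {V V' ι ι' : Type*} {a b : ι → V} {a' b' : ι' → V'} {H : SimpleGraph V}
  {H' : SimpleGraph V'} {m : ℕ}

theorem map_pathVertex {e : V → V'} {e' : ι → ι'} (ha : ∀ i, a' (e' i) = e (a i))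
    (hb : ∀ i, b' (e' i) = e (b i)) (i : ι) (k : ℕ) :
    Sum.map e (Prod.map e' id) (pathVertex a b m i k) = pathVertex a' b' m (e' i) k := by
  unfold pathVertex
  split_ifs
  exacts [congrArg Sum.inl (ha i).symm, rfl, congrArg Sum.inl (hb i).symm]

theorem deleteEdges_adj_iff_of_iso (e : H ≃g H') (e' : ι ≃ ι') (ha : ∀ i, a' (e' i) = e (a i))
    (hb : ∀ i, b' (e' i) = e (b i)) {u v : V} :
    (H'.deleteEdges (Set.range fun i => s(a' i, b' i))).Adj (e u) (e v) ↔
      (H.deleteEdges (Set.range fun i => s(a i, b i))).Adj u v := by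
  simp only [deleteEdges_adj, e.map_adj_iff, Set.mem_range, e'.surjective.exists, ha, hb,
    Sym2.eq_iff, e.injective.eq_iff]

/-- The isomorphism of path replacements induced by an isomorphism of graphs that respects the
indexed families of edges to be replaced. -/
def replaceEdgesByPathsIso (e : H ≃g H') (e' : ι ≃ ι') (ha : ∀ i, a' (e' i) = e (a i))
    (hb : ∀ i, b' (e' i) = e (b i)) :
    replaceEdgesByPaths H a b m ≃g replaceEdgesByPaths H' a' b' m where
  toEquiv := e.toEquiv.sumCongr (e'.prodCongr (Equiv.refl _))
  map_rel_iff' {x y} := by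
    let E : V ⊕ ι × Fin (m - 1) ≃ V' ⊕ ι' × Fin (m - 1) :=
      e.toEquiv.sumCongr (e'.prodCongr (Equiv.refl _))
    have hinl (v : V) : Sum.inl (e v) = E (Sum.inl v) := rfl
    have hpath (i : ι) (k : ℕ) : pathVertex a' b' m (e' i) k = E (pathVertex a b m i k) :=
      (map_pathVertex ha hb i k).symm
    change (replaceEdgesByPaths H' a' b' m).Adj (E x) (E y) ↔ _
    simp only [replaceEdgesByPaths, fromRel_adj, e.surjective.exists, e'.surjective.exists,
      deleteEdges_adj_iff_of_iso e e' ha hb, hinl, hpath, E.injective.eq_iff, E.injective.ne_iff]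

end Replacement

section Representation

variable {V V' R : Type*} [Fintype V] [Fintype V'] {G : SimpleGraph V} {G' : SimpleGraph V'}
  [DecidableRel G.Adj] [DecidableRel G'.Adj]

theorem adjMatrix_mulVec_comp_iso [NonAssocSemiring R] (e : G ≃g G') (f : V' → R) :
    G.adjMatrix R *ᵥ (f ∘ e) = (G'.adjMatrix R *ᵥ f) ∘ e := by
  ext v
  simp only [mulVec, dotProduct, Function.comp_apply]
  rw [← Equiv.sum_comp e.toEquiv]
  refine Fintype.sum_congr _ _ fun w => ?_
  simp only [adjMatrix_apply, RelIso.coe_fn_toEquiv, e.map_adj_iff]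

variable {Γ : Type*} [Group Γ]

/-- The permutation representation, on functions on the vertices, of a group acting on a graph. -/
def permRepresentation (R : Type*) [CommSemiring R] (θ : Γ →* (G ≃g G)) :
    Representation R Γ (V → R) where
  toFun γ := LinearMap.funLeft R R (θ γ⁻¹)
  map_one' := by
    ext
    simp
  map_mul' γ δ := by
    ext
    simp [LinearMap.funLeft]

/-- An eigenspace of the adjacency matrix, as a subrepresentation of the permutation
representation. -/
def eigenspaceSubrepresentation [CommRing R] (θ : Γ →* (G ≃g G)) (c : R) :
    Subrepresentation (permRepresentation R θ) where
  toSubmodule := Module.End.eigenspace (G.adjMatrix R).mulVecLin c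
  apply_mem_toSubmodule γ f hf := by
    rw [Module.End.mem_eigenspace_iff, mulVecLin_apply] at hf ⊢
    exact (adjMatrix_mulVec_comp_iso (θ γ⁻¹) f).trans (congrArg (· ∘ θ γ⁻¹) hf)

end Representation

section CayleyPathGraph

variable {Γ : Type*} [Group Γ] (σ t : Γ) (m : ℕ)

/-- The action of `Γ` on `cayleyPathGraph σ t m` by left translations. -/
def cayleyPathGraphTranslation : Γ →* (cayleyPathGraph σ t m ≃g cayleyPathGraph σ t m) where
  toFun γ := replaceEdgesByPathsIso
    { toEquiv := Equiv.mulLeft γ, map_rel_iff' := mulCayley_adj_mul_iff_right }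
    (Equiv.mulLeft γ) (fun _ => rfl) (fun g => mul_assoc γ g t)
  map_one' := by
    ext x : 1
    rcases x with g | ⟨g, j⟩ <;> simp [replaceEdgesByPathsIso]
  map_mul' γ δ := by
    ext x : 1
    rcases x with g | ⟨g, j⟩ <;> simp [replaceEdgesByPathsIso, mul_assoc]

end CayleyPathGraph

end Symmetry

section AffinePathGraph

open Matrix Module SemidirectProduct SimpleGraph

theorem eq_zero_of_pairwise_add_eq_zero {α R : Type*} [Fintype α] [CommRing R] [CharZero R]
    [NoZeroDivisors R] (hα : 2 < Fintype.card α) {φ : α → R}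
    (hφ : Pairwise fun x y => φ x + φ y = 0) : φ = 0 := by
  classical
  funext x
  obtain ⟨y, hy, z, hz, hyz⟩ := Finset.one_lt_card.mp
    (show 1 < (Finset.univ.erase x).card by
      rw [Finset.card_erase_of_mem (Finset.mem_univ x), Finset.card_univ]
      omega)
  have hxy := hφ (Finset.ne_of_mem_erase hy).symm
  have hxz := hφ (Finset.ne_of_mem_erase hz).symm
  have hdouble : 2 * φ x = 0 := by
    linear_combination hxy + hxz - hφ hyz
  exact (mul_eq_zero.mp hdouble).resolve_left two_ne_zero

namespace AffGroup

variable {F : Type*} [Field F]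

theorem toAdd_left_mul (g h : AffGroup F) :
    (g * h).left.toAdd = g.left.toAdd + g.right * h.left.toAdd :=
  rfl

theorem mem_range_inr_iff {g : AffGroup F} :
    g ∈ (inr : Fˣ →* AffGroup F).range ↔ g.left.toAdd = 0 := by
  refine ⟨?_, fun hg => ⟨g.right, SemidirectProduct.ext hg.symm rfl⟩⟩
  rintro ⟨u, rfl⟩
  rfl

theorem isCoatom_range_inr : IsCoatom (inr : Fˣ →* AffGroup F).range := by
  refine ⟨fun htop => ?_, fun K hK => (Subgroup.eq_top_iff' K).mpr fun g => ?_⟩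
  · have h1 : (inl (Multiplicative.ofAdd 1) : AffGroup F) ∈ (inr : Fˣ →* AffGroup F).range :=
      htop ▸ Subgroup.mem_top _
    exact one_ne_zero (mem_range_inr_iff.mp h1)
  obtain ⟨hrange, t, htK, ht⟩ := SetLike.lt_iff_le_and_exists.mp hK
  have inr_mem (u : Fˣ) : (inr u : AffGroup F) ∈ K := hrange ⟨u, rfl⟩
  have inl_mem_of_right {g : AffGroup F} (hg : g ∈ K) : inl g.left ∈ K := by
    rw [← inl_left_mul_inr_right g] at hg
    exact (K.mul_mem_cancel_right (inr_mem _)).mp hg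
  have inl_one_mem : inl (Multiplicative.ofAdd 1) ∈ K := by
    let u := Units.mk0 t.left.toAdd (mt mem_range_inr_iff.mpr ht)
    have h : inl (Multiplicative.ofAdd (u : F)) ∈ K := inl_mem_of_right htK
    rwa [inl_ofAdd_units_val, K.mul_mem_cancel_right (inr_mem _),
      K.mul_mem_cancel_left (inr_mem _)] at h
  rw [← inl_left_mul_inr_right g]
  refine K.mul_mem ?_ (inr_mem _)
  obtain hg | hg := eq_or_ne g.left 1
  · rw [hg, map_one]
    exact K.one_mem
  · have h := inl_ofAdd_units_val (Units.mk0 g.left.toAdd hg)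
    rw [show inl g.left = _ from h]
    exact K.mul_mem (K.mul_mem (inr_mem _) inl_one_mem) (inr_mem _)

theorem closure_eq_top {s : Fˣ} {t : AffGroup F} (hs : Subgroup.zpowers s = ⊤)
    (ht : t ∉ (inr : Fˣ →* AffGroup F).range) :
    Subgroup.closure {inr s, (inr s)⁻¹, t, t⁻¹} = ⊤ := by
  refine isCoatom_range_inr.2 _ (SetLike.lt_iff_le_and_exists.mpr ⟨?_, t, ?_, ht⟩)
  · rw [MonoidHom.range_eq_map, ← hs, MonoidHom.map_zpowers, Subgroup.zpowers_le]
    exact Subgroup.subset_closure (by simp)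
  · exact Subgroup.subset_closure (by simp)

theorem sum_right [Fintype F] [Fintype Fˣ] {M : Type*} [AddCommMonoid M] (k : Fˣ → M) :
    ∑ g : AffGroup F, k g.right = Fintype.card F • ∑ u, k u := by
  rw [← Equiv.sum_comp equivProd.symm, Fintype.sum_prod_type]
  simp [equivProd]

theorem card_eq [Fintype F] :
    Fintype.card (AffGroup F) = Fintype.card F * (Fintype.card F - 1) := by
  classical
  rw [Fintype.card_congr equivProd, Fintype.card_prod, Fintype.card_multiplicative,
    Fintype.card_units]

end AffGroup

variable {F : Type*} [Field F] {s : Fˣ} {t : AffGroup F} {m : ℕ} {μ : ℝ}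

theorem apply_inl_of_mem_invariants_inl {f : AffGroup F ⊕ AffGroup F × Fin (m - 1) → ℝ}
    (hf : f ∈ Representation.invariants
      ((permRepresentation ℝ (cayleyPathGraphTranslation (inr s) t m)).comp inl))
    (g : AffGroup F) : f (Sum.inl g) = f (Sum.inl (inr g.right)) := by
  have h := congrFun (hf g.left) (Sum.inl g)
  rw [← h]
  change f (Sum.inl ((inl g.left)⁻¹ * g)) = _
  rw [inv_mul_eq_of_eq_mul (inl_left_mul_inr_right g).symm]

variable [Fintype F]

theorem ne_inv_of_zpowers_eq_top (hq : 4 ≤ Fintype.card F) (hs : Subgroup.zpowers s = ⊤) :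
    s ≠ s⁻¹ := by
  classical
  intro h
  have hs2 : s ^ 2 = 1 := by rwa [sq, mul_eq_one_iff_eq_inv]
  have hle := orderOf_le_of_pow_eq_one two_pos hs2
  rw [orderOf_eq_card_of_zpowers_eq_top hs, Nat.card_eq_fintype_card, Fintype.card_units] at hle
  omega

theorem affine_generators_ne (hq : 4 ≤ Fintype.card F) (hs : Subgroup.zpowers s = ⊤)
    (ht : t ∉ (inr : Fˣ →* AffGroup F).range) :
    (inr s : AffGroup F) ≠ (inr s)⁻¹ ∧ t ≠ 1 ∧ inr s ≠ t ∧ inr s ≠ t⁻¹ := by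
  have hsmem : inr s ∈ (inr : Fˣ →* AffGroup F).range := ⟨s, rfl⟩
  refine ⟨?_, (ne_of_mem_of_not_mem (one_mem _) ht).symm, ne_of_mem_of_not_mem hsmem ht,
    ne_of_mem_of_not_mem hsmem (mt inv_mem_iff.mp ht)⟩
  rw [← map_inv]
  exact inr_injective.ne (ne_inv_of_zpowers_eq_top hq hs)

theorem sum_right_mul_inr_le_cos_mul_sum_sq (hs : Subgroup.zpowers s = ⊤) {h : Fˣ → ℝ}
    (hsum : ∑ g : AffGroup F, h g.right = 0) :
    ∑ g : AffGroup F, h g.right * h (g * inr s).right ≤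
      Real.cos (2 * Real.pi / ((Fintype.card F : ℝ) - 1)) * ∑ g : AffGroup F, h g.right ^ 2 := by
  classical
  have hq : (0 : ℝ) < Fintype.card F := Nat.cast_pos.mpr Fintype.card_pos
  have hcard : (Fintype.card (Additive Fˣ) : ℝ) = Fintype.card F - 1 := by
    rw [Fintype.card_additive, Fintype.card_units, Nat.cast_pred Fintype.card_pos]
  rw [AffGroup.sum_right, nsmul_eq_mul, mul_eq_zero_iff_left hq.ne'] at hsum
  have hgen : AddSubgroup.zmultiples (Additive.ofMul s) = ⊤ := by
    rw [AddSubgroup.eq_top_iff']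
    exact fun u => (Subgroup.eq_top_iff' _).mp hs u.toMul
  have hcos := sum_mul_add_le_cos_mul_sum_sq (s := Additive.ofMul s) (h := h ∘ Additive.toMul)
    hgen ((Equiv.sum_comp Additive.toMul h).trans hsum)
  rw [hcard] at hcos
  simp only [mul_right, right_inr]
  rw [AffGroup.sum_right fun u => h u * h (u * s), AffGroup.sum_right fun u => h u ^ 2,
    nsmul_eq_mul, nsmul_eq_mul, mul_left_comm]
  refine mul_le_mul_of_nonneg_left ?_ hq.le
  rw [← Equiv.sum_comp Additive.toMul, ← Equiv.sum_comp Additive.toMul fun u => h u ^ 2]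
  exact (Fintype.sum_congr _ _ fun u => mul_comm _ _).trans_le hcos

namespace PathProfile

theorem dotProduct_adjMatrix_mulVec_le_of_mem_invariants_inl (h : PathProfile m μ) (hm : 2 ≤ m)
    (hq : 4 ≤ Fintype.card F) (hs : Subgroup.zpowers s = ⊤)
    (ht : t ∉ (inr : Fˣ →* AffGroup F).range)
    [DecidableRel (cayleyPathGraph (inr s) t m).Adj]
    (hμ : 2 * Real.cos (2 * Real.pi / ((Fintype.card F : ℝ) - 1)) + 2 * h.p 1 ≤ μ)
    {f : AffGroup F ⊕ AffGroup F × Fin (m - 1) → ℝ}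
    (hf : f ∈ Representation.invariants
      ((permRepresentation ℝ (cayleyPathGraphTranslation (inr s) t m)).comp inl))
    (hsum : ∑ g, f (Sum.inl g) = 0) :
    f ⬝ᵥ (cayleyPathGraph (inr s) t m).adjMatrix ℝ *ᵥ f ≤ μ * f ⬝ᵥ f := by
  obtain ⟨hσ, ht1, hσt, hσt'⟩ := affine_generators_ne hq hs ht
  have hf := apply_inl_of_mem_invariants_inl hf
  refine h.dotProduct_adjMatrix_mulVec_cayleyPathGraph_le hm hσ ht1 hσt hσt' hμ ?_
  rw [Fintype.sum_congr _ _ hf] at hsum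
  rw [Fintype.sum_congr _ _ fun g => congrArg₂ (· * ·) (hf g) (hf (g * inr s)),
    Fintype.sum_congr _ _ fun g => congrArg (· ^ 2) (hf g)]
  exact sum_right_mul_inr_le_cos_mul_sum_sq hs (h := fun u => f (Sum.inl (inr u))) hsum

theorem lt_dotProduct_adjMatrix_mulVec_interpolant_left (h : PathProfile m μ) (hm : 2 ≤ m)
    (hq : 4 ≤ Fintype.card F) (hs : Subgroup.zpowers s = ⊤)
    (ht : t ∉ (inr : Fˣ →* AffGroup F).range)
    [DecidableRel (cayleyPathGraph (inr s) t m).Adj] (hμ : μ ≤ 2 + 2 * h.r 1)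
    (hrp : h.r 1 < h.p 1) {φ : F → ℝ} (hφ : φ ≠ 0) :
    let f := h.interpolant (fun g => g) (fun g => g * t) fun g : AffGroup F => φ g.left.toAdd
    μ * f ⬝ᵥ f < f ⬝ᵥ (cayleyPathGraph (inr s) t m).adjMatrix ℝ *ᵥ f := by
  obtain ⟨hσ, ht1, hσt, hσt'⟩ := affine_generators_ne hq hs ht
  refine h.lt_dotProduct_adjMatrix_mulVec_interpolant_cayleyPathGraph hm hσ ht1 hσt hσt' hμ hrp
    (fun g => by simp) ?_
  contrapose! hφ
  refine eq_zero_of_pairwise_add_eq_zero (by omega) fun x y hxy => ?_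
  have ht0 : t.left.toAdd ≠ 0 := mt AffGroup.mem_range_inr_iff.mpr ht
  let u := Units.mk0 ((y - x) / t.left.toAdd) (div_ne_zero (sub_ne_zero.mpr hxy.symm) ht0)
  have hu := hφ ⟨Multiplicative.ofAdd x, u⟩
  rw [AffGroup.toAdd_left_mul] at hu
  simpa [u, ht0] using hu

end PathProfile

theorem card_sub_one_le_secondEigenvalueMultiplicity_affinePathGraph
    (hq : 4 ≤ Fintype.card F) (hs : Subgroup.zpowers s = ⊤)
    (ht : t ∉ (inr : Fˣ →* AffGroup F).range) :
    Fintype.card F - 1 ≤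
      secondEigenvalueMultiplicity (affinePathGraph s t (pathLength (Fintype.card F))) := by
  classical
  obtain ⟨μ, h, hμr, hrp, hμp⟩ := exists_pathProfile_pathLength hq
  have hm := (pathLength_bounds hq).1
  let θ := cayleyPathGraphTranslation (inr s) t (pathLength (Fintype.card F))
  let test := h.interpolant (fun g => g) (fun g => g * t) ∘ₗ
    LinearMap.funLeft ℝ ℝ fun g : AffGroup F => g.left.toAdd
  have htest : Function.Injective test := by
    rw [LinearMap.coe_comp]
    refine (h.interpolant_injective _ _).comp (LinearMap.funLeft_injective_of_surjective ℝ ℝ _ ?_)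
    exact fun x => ⟨inl (Multiplicative.ofAdd x), rfl⟩
  refine le_secondEigenvalueMultiplicity (cayleyPathGraph (inr s) t _) (by omega) (μ := μ)
    (U := LinearMap.range test) ?_ ?_
    (N := Representation.invariants ((permRepresentation ℝ θ).comp inl)) (fun c => ?_)
    (∑ g, LinearMap.proj (Sum.inl g)) fun f hf hsum => ?_
  · rw [LinearMap.finrank_range_of_inj htest, finrank_fintype_fun_eq_card]
    omega
  · rintro _ ⟨φ, rfl⟩ hφ
    exact h.lt_dotProduct_adjMatrix_mulVec_interpolant_left hm hq hs ht hμr hrp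
      fun h0 => hφ (by rw [h0, map_zero])
  · exact AffGroup.le_invariants_inl_or_card_sub_one_le_finrank (eigenspaceSubrepresentation θ c)
  · exact h.dotProduct_adjMatrix_mulVec_le_of_mem_invariants_inl hm hq hs ht hμp hf
      (by simpa using hsum)

end AffinePathGraph

section Conclusion

open SemidirectProduct

theorem secondEigenvalueMultiplicity_congr {V W : Type*} [Fintype V] [Fintype W]
    {G : SimpleGraph V} {H : SimpleGraph W} (e : G ≃g H) :
    secondEigenvalueMultiplicity G = secondEigenvalueMultiplicity H := by
  classical
  have hmat : H.adjMatrix ℝ = Matrix.reindex e.toEquiv e.toEquiv (G.adjMatrix ℝ) := by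
    ext x y
    simp only [SimpleGraph.adjMatrix_apply, Matrix.reindex_apply, Matrix.submatrix_apply]
    congr 1
    exact propext e.symm.map_adj_iff.symm
  have hlist : List.ofFn (adjEigenvalue G) = List.ofFn (adjEigenvalue H) := by
    unfold adjEigenvalue
    rw [← Matrix.IsHermitian.sort_roots_charpoly_eq_eigenvalues₀,
      ← Matrix.IsHermitian.sort_roots_charpoly_eq_eigenvalues₀, hmat, Matrix.charpoly_reindex]
  exact congrArg (fun p : Σ n, Fin n → ℝ =>
    Nat.card {j : Fin p.1 // ∃ h : 1 < p.1, p.2 j = p.2 ⟨1, h⟩}) (List.ofFn_inj'.mp hlist)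

theorem graphMaxDegree_congr {V W : Type*} [Fintype V] [Fintype W]
    {G : SimpleGraph V} {H : SimpleGraph W} (e : G ≃g H) : graphMaxDegree G = graphMaxDegree H := by
  classical
  exact e.maxDegree_eq

theorem affinePathGraph_pathLength {F : Type*} [Field F] [Fintype F] {s : Fˣ} {t : AffGroup F}
    {q n : ℕ} (hqF : q = Fintype.card F) (hq : 4 ≤ q) (hn : n = q * (q - 1) * pathLength q)
    (hs : Subgroup.zpowers s = ⊤) (ht : t ∉ (inr : Fˣ →* AffGroup F).range) :
    Fintype.card (AffGroup F ⊕ AffGroup F × Fin (pathLength q - 1)) = n ∧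
      (affinePathGraph s t (pathLength q)).Connected ∧
      graphMaxDegree (affinePathGraph s t (pathLength q)) = 4 ∧
      q - 1 ≤ secondEigenvalueMultiplicity (affinePathGraph s t (pathLength q)) ∧
      √((n : ℝ) / Real.logb 2 (n : ℝ)) ≤
        (secondEigenvalueMultiplicity (affinePathGraph s t (pathLength q)) : ℝ) := by
  subst hqF hn
  obtain ⟨hσ, ht1, hσt, hσt'⟩ := affine_generators_ne hq hs ht
  have hm := (pathLength_bounds hq).1
  have hmult := card_sub_one_le_secondEigenvalueMultiplicity_affinePathGraph hq hs ht
  refine ⟨?_, cayleyPathGraph_connected hm (AffGroup.closure_eq_top hs ht),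
    graphMaxDegree_cayleyPathGraph hm hσ ht1 hσt hσt', hmult, ?_⟩
  · rw [card_sum_prod_fin_sub_one (by omega), AffGroup.card_eq]
  · refine (sqrt_card_div_logb_le hq).trans ?_
    rw [sub_le_iff_le_add]
    exact_mod_cast Nat.sub_le_iff_le_add.mp hmult

theorem exists_connected_graph_sqrt_le_secondEigenvalueMultiplicity {p n : ℕ} (hp : p.Prime)
    (hp4 : 4 ≤ p) (hn : n = p * (p - 1) * pathLength p) :
    ∃ G : SimpleGraph (Fin n), G.Connected ∧ graphMaxDegree G = 4 ∧
      √((n : ℝ) / Real.logb 2 (n : ℝ)) ≤ (secondEigenvalueMultiplicity G : ℝ) := by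
  have : Fact p.Prime := ⟨hp⟩
  obtain ⟨s, hs⟩ := IsCyclic.exists_zpow_surjective (G := (ZMod p)ˣ)
  have ht : (inl (Multiplicative.ofAdd 1) : AffGroup (ZMod p)) ∉
      (inr : (ZMod p)ˣ →* AffGroup (ZMod p)).range :=
    mt AffGroup.mem_range_inr_iff.mp one_ne_zero
  obtain ⟨hcard, hconn, hdeg, -, hmult⟩ := affinePathGraph_pathLength (ZMod.card p).symm hp4 hn
    ((Subgroup.eq_top_iff' _).mpr hs) ht
  let e := (affinePathGraph s (inl (Multiplicative.ofAdd 1)) (pathLength p)).overFinIso hcard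
  exact ⟨_, e.connected_iff.mp hconn, graphMaxDegree_congr e ▸ hdeg,
    secondEigenvalueMultiplicity_congr e ▸ hmult⟩

end Conclusion

theorem theorem1p5 :
    {n : ℕ | ∃ G : SimpleGraph (Fin n), G.Connected ∧ graphMaxDegree G = 4 ∧
      √((n : ℝ) / Real.logb 2 (n : ℝ)) ≤ (secondEigenvalueMultiplicity G : ℝ)}.Infinite ∧
    ∀ (F : Type) [Field F] [Fintype F] (q m n : ℕ) (s : Fˣ) (t : AffGroup F),
      q = Fintype.card F → 4 ≤ q → m = pathLength q → n = q * (q - 1) * m →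
      Subgroup.zpowers s = ⊤ →
      t ∉ (SemidirectProduct.inr : Fˣ →* AffGroup F).range → t ≠ t⁻¹ →
      Fintype.card (AffGroup F ⊕ AffGroup F × Fin (m - 1)) = n ∧
      (affinePathGraph s t m).Connected ∧
      graphMaxDegree (affinePathGraph s t m) = 4 ∧
      q - 1 ≤ secondEigenvalueMultiplicity (affinePathGraph s t m) ∧
      √((n : ℝ) / Real.logb 2 (n : ℝ)) ≤
        (secondEigenvalueMultiplicity (affinePathGraph s t m) : ℝ) := by
  constructor
  · refine Set.infinite_of_forall_exists_gt fun N => ?_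
    obtain ⟨p, hNp, hp⟩ := Nat.exists_infinite_primes (N + 4)
    have hp4 : 4 ≤ p := by omega
    refine ⟨p * (p - 1) * pathLength p,
      exists_connected_graph_sqrt_le_secondEigenvalueMultiplicity hp hp4 rfl, ?_⟩
    calc N < p := by omega
      _ ≤ p * (p - 1) := Nat.le_mul_of_pos_right p (by omega)
      _ ≤ p * (p - 1) * pathLength p :=
        Nat.le_mul_of_pos_right _ (two_pos.trans_le (pathLength_bounds hp4).1)
  · rintro F _ _ q _ n s t hqF hq rfl hn hs ht -
    exact affinePathGraph_pathLength hqF hq hn hs ht
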